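/- Let $\mathbf k$ be a field and let $\Omega$ be a finite set with $w$ elements. A \emph{diassociative semigroup} structure on $\Omega$ is a pair of maps $\leftarrow,\rightarrow:\Omega\times\Omega\to\Omega$ such that, for all $\alpha,\beta,\gamma$, $(\alpha\leftarrow\beta)\leftarrow\gamma=\alpha\leftarrow(\beta\leftarrow\gamma)=\alpha\leftarrow(\beta\rightarrow\gamma)$, $(\alpha\rightarrow\beta)\leftarrow\gamma=\alpha\rightarrow(\beta\leftarrow\gamma)$ and $(\alpha\rightarrow\beta)\rightarrow\gamma=(\alpha\leftarrow\beta)\rightarrow\gamma=\alpha\rightarrow(\beta\rightarrow\gamma)$. A \emph{duplicial semigroup} structure is such a pair satisfying only $(\alpha\leftarrow\beta)\leftarrow\gamma=\alpha\leftarrow(\beta\leftarrow\gamma)$, $(\alpha\rightarrow\beta)\leftarrow\gamma=\alpha\rightarrow(\beta\leftarrow\gamma)$ and $(\alpha\rightarrow\beta)\rightarrow\gamma=\alpha\rightarrow(\beta\rightarrow\gamma)$. For a diassociative semigroup $\Omega$, let $\mathbf{Dend}^2_\Omega$ be the $\mathbf k$-linear non-symmetric operad generated by binary operations $\prec_{\alpha,\beta},\succ_{\alpha,\beta}$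 ($\alpha,\beta\in\Omega$) subject to the relations, for all $\alpha,\beta,\gamma\in\Omega$, \begin{align*} (x\prec_{\alpha,\beta}y)\prec_{\alpha\leftarrow\beta,\gamma}z&=x\prec_{\alpha,\beta\leftarrow\gamma}(y\prec_{\beta,\gamma}z)+x\prec_{\alpha,\beta\rightarrow\gamma}(y\succ_{\beta,\gamma}z),\\ (x\succ_{\alpha,\beta}y)\prec_{\alpha\rightarrow\beta,\gamma}z&=x\succ_{\alpha,\beta\leftarrow\gamma}(y\prec_{\beta,\gamma}z),\\ x\succ_{\alpha,\beta\rightarrow\gamma}(y\succ_{\beta,\gamma}z)&=(x\succ_{\alpha,\beta}y)\succ_{\alpha\rightarrow\beta,\gamma}z+(x\prec_{\alpha,\beta}y)\succ_{\alpha\leftarrow\beta,\gamma}z. \end{align*} For a duplicial semigroup $\Omega$, let $\mathbf{Dup}^2_\Omega$ be the $\mathbf k$-linear non-symmetric operad generated by binary operations $\prec_{\alpha,\beta},\succ_{\alpha,\beta}$ ($\alpha,\beta\in\Omega$) subject to the relations, for all $\alpha,\beta,\gamma\in\Omega$, \begin{align*} (x\prec_{\alpha,\beta}y)\prec_{\alpha\leftarrow\beta,\gamma}z&=x\prec_{\alpha,\beta\leftarrow\gamma}(y\prec_{\beta,\gamma}z),\\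 (x\succ_{\alpha,\beta}y)\prec_{\alpha\rightarrow\beta,\gamma}z&=x\succ_{\alpha,\beta\leftarrow\gamma}(y\prec_{\beta,\gamma}z),\\ x\succ_{\alpha,\beta\rightarrow\gamma}(y\succ_{\beta,\gamma}z)&=(x\succ_{\alpha,\beta}y)\succ_{\alpha\rightarrow\beta,\gamma}z. \end{align*} Let $\mathrm{Cat}_n=\frac1n\binom{2n-2}{n-1}$ (so $\mathrm{Cat}_1=1,\ \mathrm{Cat}_2=1,\ \mathrm{Cat}_3=2,\ \mathrm{Cat}_4=5,\dots$). \textbf{Proposition.} Let $n\geq1$. There is a polynomial $r_n\in\mathbb Z[w]$ such that, for every field $\mathbf k$ and every finite set $\Omega$, the component of arity $n$ of $\mathbf{Dend}^2_\Omega$ (for every diassociative semigroup structure on $\Omega$) and that of $\mathbf{Dup}^2_\Omega$ (for every duplicial semigroup structure on $\Omega$) are finite-dimensional of dimension $r_n(|\Omega|)$. Moreover: \begin{enumerate} \item $r_n$ has degree $2n-2$ and leading coefficient $2^{n-1}\,\mathrm{Cat}_n$. \item If $n\geq2$, there is a polynomial $t_n\in\mathbb Z[w]$ such that $r_n=w^nt_n$,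 and $t_n(0)=(-1)^n\,n$. \end{enumerate} -/

import Mathlib

universe u v w

/-! ### Non-symmetric operads over a commutative ring, by partial compositions -/

/-- A `k`-linear non-symmetric (non-sigma) operad. `comp hp i x y` is the partial composite
`x ∘ᵢ y`, where the inputs of `x` are numbered `0, …, m - 1`; the arity `p = m + n - 1` of the
composite is passed together with the equation `p + 1 = m + n`. -/
structure NSOperad (k : Type u) [CommRing k] where
  obj : ℕ → Type w
  [addCommGroup : ∀ n, AddCommGroup (obj n)]
  [module : ∀ n, Module k (obj n)]
  one : obj 1
  comp : ∀ {m n p : ℕ}, p + 1 = m + n → Fin m → (obj m →ₗ[k] obj n →ₗ[k] obj p)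
  one_comp : ∀ {n : ℕ} (h : n + 1 = 1 + n) (x : obj n), comp h 0 one x = x
  comp_one : ∀ {m : ℕ} (h : m + 1 = m + 1) (i : Fin m) (x : obj m), comp h i x one = x
  comp_seq : ∀ {m n q p p' r : ℕ} (h₁ : p + 1 = m + n) (h₂ : r + 1 = p + q)
    (h₃ : p' + 1 = n + q) (h₄ : r + 1 = m + p') (i : Fin m) (j : Fin n) (l : Fin p)
    (_ : (l : ℕ) = i + j) (x : obj m) (y : obj n) (z : obj q),
    comp h₂ l (comp h₁ i x y) z = comp h₄ i x (comp h₃ j y z)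
  comp_par : ∀ {m n q p p' r : ℕ} (h₁ : p + 1 = m + n) (h₂ : r + 1 = p + q)
    (h₃ : p' + 1 = m + q) (h₄ : r + 1 = p' + n) (i j : Fin m) (_ : i < j) (l : Fin p)
    (_ : (l : ℕ) + 1 = j + n) (i' : Fin p') (_ : (i' : ℕ) = i)
    (x : obj m) (y : obj n) (z : obj q),
    comp h₂ l (comp h₁ i x y) z = comp h₄ i' (comp h₃ j x z) y

namespace NSOperad

attribute [instance] NSOperad.addCommGroup NSOperad.module

variable {k : Type u} [CommRing k]

/-- An operadic ideal: a family of submodules stable under composition on either side with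
arbitrary operations. -/
structure Ideal (P : NSOperad.{u, w} k) where
  carrier : ∀ n, Submodule k (P.obj n)
  comp_left_mem : ∀ {m n p : ℕ} (h : p + 1 = m + n) (i : Fin m) (x : P.obj m) (y : P.obj n),
    x ∈ carrier m → P.comp h i x y ∈ carrier p
  comp_right_mem : ∀ {m n p : ℕ} (h : p + 1 = m + n) (i : Fin m) (x : P.obj m) (y : P.obj n),
    y ∈ carrier n → P.comp h i x y ∈ carrier p

/-- The smallest operadic ideal containing the given sets of operations. -/
def idealSpan (P : NSOperad.{u, w} k) (R : ∀ n, Set (P.obj n)) : P.Ideal where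
  carrier n := ⨅ J : {J : P.Ideal // ∀ m, R m ⊆ J.carrier m}, J.1.carrier n
  comp_left_mem h i x y hx := by
    rw [Submodule.mem_iInf] at hx ⊢
    exact fun J => J.1.comp_left_mem h i x y (hx J)
  comp_right_mem h i x y hy := by
    rw [Submodule.mem_iInf] at hy ⊢
    exact fun J => J.1.comp_right_mem h i x y (hy J)

/-- Partial composition on the quotient by an operadic ideal. -/
def quotientComp (P : NSOperad.{u, w} k) (I : P.Ideal) {m n p : ℕ} (h : p + 1 = m + n)
    (i : Fin m) :
    (P.obj m ⧸ I.carrier m) →ₗ[k] (P.obj n ⧸ I.carrier n) →ₗ[k] (P.obj p ⧸ I.carrier p) :=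
  (I.carrier m).liftQ
    ((Submodule.mapQLinear (I.carrier n) (I.carrier p)).comp
      ((P.comp h i).codRestrict (Submodule.compatibleMaps (I.carrier n) (I.carrier p))
        (fun x y hy => I.comp_right_mem h i x y hy)))
    (by
      intro x hx
      rw [LinearMap.mem_ker]
      refine LinearMap.ext fun y => ?_
      obtain ⟨y, rfl⟩ := Submodule.Quotient.mk_surjective _ y
      exact (Submodule.Quotient.mk_eq_zero _).2 (I.comp_left_mem h i x y hx))

/-- The quotient of an operad by an operadic ideal. -/
def quotient (P : NSOperad.{u, w} k) (I : P.Ideal) : NSOperad.{u, w} k where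
  obj n := P.obj n ⧸ I.carrier n
  one := Submodule.Quotient.mk P.one
  comp h i := P.quotientComp I h i
  one_comp h x := by
    obtain ⟨x, rfl⟩ := Submodule.Quotient.mk_surjective _ x
    exact congrArg Submodule.Quotient.mk (P.one_comp h x)
  comp_one h i x := by
    obtain ⟨x, rfl⟩ := Submodule.Quotient.mk_surjective _ x
    exact congrArg Submodule.Quotient.mk (P.comp_one h i x)
  comp_seq h₁ h₂ h₃ h₄ i j l hl x y z := by
    obtain ⟨x, rfl⟩ := Submodule.Quotient.mk_surjective _ x
    obtain ⟨y, rfl⟩ := Submodule.Quotient.mk_surjective _ y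
    obtain ⟨z, rfl⟩ := Submodule.Quotient.mk_surjective _ z
    exact congrArg Submodule.Quotient.mk (P.comp_seq h₁ h₂ h₃ h₄ i j l hl x y z)
  comp_par h₁ h₂ h₃ h₄ i j hij l hl i' hi' x y z := by
    obtain ⟨x, rfl⟩ := Submodule.Quotient.mk_surjective _ x
    obtain ⟨y, rfl⟩ := Submodule.Quotient.mk_surjective _ y
    obtain ⟨z, rfl⟩ := Submodule.Quotient.mk_surjective _ z
    exact congrArg Submodule.Quotient.mk
      (P.comp_par h₁ h₂ h₃ h₄ i j hij l hl i' hi' x y z)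

end NSOperad

/-! ### The free non-symmetric operad on a set of binary generators -/

/-- Planar binary trees with internal vertices decorated by `G`. -/
inductive BinTree (G : Type v) : Type v
  | leaf : BinTree G
  | node : G → BinTree G → BinTree G → BinTree G

namespace BinTree

variable {G : Type v}

/-- Number of leaves. -/
def leaves : BinTree G → ℕ
  | leaf => 1
  | node _ l r => l.leaves + r.leaves

/-- `graft s i t` grafts the root of `t` on the leaf number `i` of `s`, the leaves being numbered
from left to right starting from `0` (this is only used for `i < s.leaves`). -/
def graft : BinTree G → ℕ → BinTree G → BinTree G
  | leaf, _, t => t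
  | node g l r, i, t =>
    if i < l.leaves then node g (graft l i t) r else node g l (graft r (i - l.leaves) t)

theorem leaves_graft (s t : BinTree G) (i : ℕ) (hi : i < s.leaves) :
    (graft s i t).leaves + 1 = s.leaves + t.leaves := by
  induction s generalizing i with
  | leaf => simp [graft, leaves, add_comm]
  | node g l r ihl ihr =>
    simp only [leaves] at hi
    simp only [graft]
    split_ifs with h
    · have := ihl i h
      simp only [leaves]; omega
    · have := ihr (i - l.leaves) (by omega)
      simp only [leaves]; omega

theorem graft_leaf (s : BinTree G) (i : ℕ) : graft s i leaf = s := by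
  induction s generalizing i with
  | leaf => rfl
  | node g l r ihl ihr => simp only [graft, ihl, ihr, ite_self]

theorem graft_seq (s t z : BinTree G) (i j : ℕ) (hi : i < s.leaves) (hj : j < t.leaves) :
    graft (graft s i t) (i + j) z = graft s i (graft t j z) := by
  induction s generalizing i with
  | leaf =>
    have : i = 0 := by simpa [leaves] using hi
    simp [graft, this]
  | node g l r ihl ihr =>
    simp only [leaves] at hi
    by_cases h : i < l.leaves
    · have h1 := leaves_graft l t i h
      have h2 : i + j < (graft l i t).leaves := by omega
      simp only [graft, if_pos h, if_pos h2, ihl i h]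
    · have h2 : ¬ i + j < l.leaves := by omega
      have h3 : i + j - l.leaves = i - l.leaves + j := by omega
      simp only [graft, if_neg h, if_neg h2, h3, ihr (i - l.leaves) (by omega)]

theorem graft_par (s t z : BinTree G) (i j a : ℕ) (hij : i < j) (hj : j < s.leaves)
    (ha : a + 1 = j + t.leaves) :
    graft (graft s i t) a z = graft (graft s j z) i t := by
  induction s generalizing i j a with
  | leaf => simp only [leaves] at hj; omega
  | node g l r ihl ihr =>
    simp only [leaves] at hj
    by_cases h : i < l.leaves
    · have h1 := leaves_graft l t i h
      by_cases h' : j < l.leaves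
      · have h2 := leaves_graft l z j h'
        have h3 : a < (graft l i t).leaves := by omega
        have h4 : i < (graft l j z).leaves := by
          have : 0 < z.leaves := by
            clear ihl ihr h2
            induction z with
            | leaf => simp [leaves]
            | node g l r ihl ihr => simp only [leaves]; omega
          omega
        simp only [graft, if_pos h, if_pos h', if_pos h3, if_pos h4, ihl i j a hij h' ha]
      · have h3 : ¬ a < (graft l i t).leaves := by omega
        have h4 : a - (graft l i t).leaves = j - l.leaves := by omega
        simp only [graft, if_pos h, if_neg h', if_neg h3, h4]
    · have h' : ¬ j < l.leaves := by omega
      have h3 : ¬ a < l.leaves := by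
        have : 0 < t.leaves := by
          clear ihl ihr ha
          induction t with
          | leaf => simp [leaves]
          | node g l r ihl ihr => simp only [leaves]; omega
        omega
      simp only [graft, if_neg h, if_neg h', if_neg h3,
        ihr (i - l.leaves) (j - l.leaves) (a - l.leaves) (by omega) (by omega) (by omega)]

end BinTree

/-- Trees with exactly `n` leaves. -/
abbrev BinTreeN (G : Type v) (n : ℕ) : Type v := {t : BinTree G // t.leaves = n}

/-- Grafting, with arities. -/
def BinTreeN.graft {G : Type v} {m n p : ℕ} (h : p + 1 = m + n) (i : Fin m) (s : BinTreeN G m)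
    (t : BinTreeN G n) : BinTreeN G p :=
  ⟨s.1.graft i t.1, by
    have := BinTree.leaves_graft s.1 t.1 i (by rw [s.2]; exact i.2)
    rw [s.2, t.2] at this
    omega⟩

/-- The bilinear extension of grafting. -/
noncomputable def freeComp (k : Type u) [CommRing k] (G : Type v) {m n p : ℕ}
    (h : p + 1 = m + n) (i : Fin m) :
    (BinTreeN G m →₀ k) →ₗ[k] (BinTreeN G n →₀ k) →ₗ[k] (BinTreeN G p →₀ k) :=
  Finsupp.linearCombination k fun s => Finsupp.lmapDomain k k (BinTreeN.graft h i s)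

theorem freeComp_single (k : Type u) [CommRing k] (G : Type v) {m n p : ℕ}
    (h : p + 1 = m + n) (i : Fin m) (s : BinTreeN G m) (t : BinTreeN G n) (a b : k) :
    freeComp k G h i (Finsupp.single s a) (Finsupp.single t b) =
      Finsupp.single (BinTreeN.graft h i s t) (a * b) := by
  simp [freeComp, Finsupp.linearCombination_single, Finsupp.mapDomain_single]

/-- The free non-symmetric operad on a set `G` of binary operations: in arity `n`, the free module
on planar binary trees with `n` leaves and internal vertices decorated by `G`. -/
noncomputable def freeBinaryOperad (k : Type u) [CommRing k] (G : Type v) :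
    NSOperad.{u, max u v} k where
  obj n := BinTreeN G n →₀ k
  one := Finsupp.single ⟨BinTree.leaf, rfl⟩ 1
  comp h i := freeComp k G h i
  one_comp h x := by
    induction x using Finsupp.induction_linear with
    | zero => simp
    | add f g hf hg => rw [map_add, hf, hg]
    | single t a => rw [freeComp_single, one_mul]; rfl
  comp_one h i x := by
    induction x using Finsupp.induction_linear with
    | zero => simp
    | add f g hf hg => rw [map_add, LinearMap.add_apply, hf, hg]
    | single t a =>
      rw [freeComp_single, mul_one]
      congr 1
      exact Subtype.ext (BinTree.graft_leaf _ _)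
  comp_seq h₁ h₂ h₃ h₄ i j l hl x y z := by
    induction x using Finsupp.induction_linear with
    | zero => simp
    | add f g hf hg => simp only [map_add, LinearMap.add_apply, hf, hg]
    | single s a =>
      induction y using Finsupp.induction_linear with
      | zero => simp
      | add f g hf hg => simp only [map_add, LinearMap.add_apply, hf, hg]
      | single t b =>
        induction z using Finsupp.induction_linear with
        | zero => simp
        | add f g hf hg => simp only [map_add, hf, hg]
        | single z c =>
          simp only [freeComp_single, mul_assoc]
          congr 1
          refine Subtype.ext ?_
          simp only [BinTreeN.graft, hl]
          exact BinTree.graft_seq _ _ _ _ _ (by rw [s.2]; exact i.2) (by rw [t.2]; exact j.2)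
  comp_par h₁ h₂ h₃ h₄ i j hij l hl i' hi' x y z := by
    induction x using Finsupp.induction_linear with
    | zero => simp
    | add f g hf hg => simp only [map_add, LinearMap.add_apply, hf, hg]
    | single s a =>
      induction y using Finsupp.induction_linear with
      | zero => simp
      | add f g hf hg => simp only [map_add, LinearMap.add_apply, hf, hg]
      | single t b =>
        induction z using Finsupp.induction_linear with
        | zero => simp
        | add f g hf hg => simp only [map_add, LinearMap.add_apply, hf, hg]
        | single z c =>
          simp only [freeComp_single, mul_right_comm]
          congr 1
          refine Subtype.ext ?_
          simp only [BinTreeN.graft, hi']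
          exact BinTree.graft_par _ _ _ _ _ _ hij (by rw [s.2]; exact j.2) (by rw [t.2]; exact hl)

/-! ### Diassociative and duplicial semigroups -/

/-- A diassociative semigroup; `la` is `←` and `ra` is `→`. -/
class DiassociativeSemigroup (Ω : Type v) where
  la : Ω → Ω → Ω
  ra : Ω → Ω → Ω
  la_assoc : ∀ α β γ, la (la α β) γ = la α (la β γ)
  la_la_eq_la_ra : ∀ α β γ, la α (la β γ) = la α (ra β γ)
  ra_la : ∀ α β γ, la (ra α β) γ = ra α (la β γ)
  ra_ra_eq_la_ra : ∀ α β γ, ra (ra α β) γ = ra (la α β) γ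
  ra_assoc : ∀ α β γ, ra (la α β) γ = ra α (ra β γ)

/-- A duplicial semigroup; `la` is `←` and `ra` is `→`. -/
class DuplicialSemigroup (Ω : Type v) where
  la : Ω → Ω → Ω
  ra : Ω → Ω → Ω
  la_assoc : ∀ α β γ, la (la α β) γ = la α (la β γ)
  ra_la : ∀ α β γ, la (ra α β) γ = ra α (la β γ)
  ra_assoc : ∀ α β γ, ra (ra α β) γ = ra α (ra β γ)

/-! ### The operads of two-parameter dendriform and duplicial algebras -/

/-- The generating binary operations: `≺_{α,β}` and `≻_{α,β}`, for `α, β ∈ Ω`. -/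
inductive TwoParamOp (Ω : Type v) : Type v
  | prec : Ω → Ω → TwoParamOp Ω
  | succ : Ω → Ω → TwoParamOp Ω

namespace TwoParamOp

/-- The free operad on the operations `≺_{α,β}` and `≻_{α,β}`. -/
noncomputable abbrev Free (k : Type u) [Field k] (Ω : Type v) : NSOperad.{u, max u v} k :=
  freeBinaryOperad k (TwoParamOp Ω)

/-- A generator as an element of arity `2` of the free operad. -/
noncomputable def gen (k : Type u) [Field k] {Ω : Type v} (a : TwoParamOp Ω) :
    (Free k Ω).obj 2 :=
  Finsupp.single ⟨BinTree.node a BinTree.leaf BinTree.leaf, rfl⟩ 1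

/-- The operation `(x, y, z) ↦ (x a y) b z`. -/
noncomputable def leftComb (k : Type u) [Field k] {Ω : Type v} (a b : TwoParamOp Ω) :
    (Free k Ω).obj 3 :=
  (Free k Ω).comp (m := 2) (n := 2) (p := 3) rfl 0 (gen k b) (gen k a)

/-- The operation `(x, y, z) ↦ x a (y b z)`. -/
noncomputable def rightComb (k : Type u) [Field k] {Ω : Type v} (a b : TwoParamOp Ω) :
    (Free k Ω).obj 3 :=
  (Free k Ω).comp (m := 2) (n := 2) (p := 3) rfl 1 (gen k a) (gen k b)

end TwoParamOp

open TwoParamOp in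
/-- The defining relations of two-parameter dendriform algebras:
* `(x ≺_{α,β} y) ≺_{α←β,γ} z = x ≺_{α,β←γ} (y ≺_{β,γ} z) + x ≺_{α,β→γ} (y ≻_{β,γ} z)`,
* `(x ≻_{α,β} y) ≺_{α→β,γ} z = x ≻_{α,β←γ} (y ≺_{β,γ} z)`,
* `x ≻_{α,β→γ} (y ≻_{β,γ} z) = (x ≻_{α,β} y) ≻_{α→β,γ} z + (x ≺_{α,β} y) ≻_{α←β,γ} z`. -/
inductive DendRel (k : Type u) [Field k] (Ω : Type v) [DiassociativeSemigroup Ω] :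
    ∀ n, (Free k Ω).obj n → Prop
  | prec (α β γ : Ω) : DendRel k Ω 3
      (leftComb k (prec α β) (prec (DiassociativeSemigroup.la α β) γ)
        - (rightComb k (prec α (DiassociativeSemigroup.la β γ)) (prec β γ)
          + rightComb k (prec α (DiassociativeSemigroup.ra β γ)) (succ β γ)))
  | mid (α β γ : Ω) : DendRel k Ω 3
      (leftComb k (succ α β) (prec (DiassociativeSemigroup.ra α β) γ)
        - rightComb k (succ α (DiassociativeSemigroup.la β γ)) (prec β γ))
  | succ (α β γ : Ω) : DendRel k Ω 3
      (rightComb k (succ α (DiassociativeSemigroup.ra β γ)) (succ β γ)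
        - (leftComb k (succ α β) (succ (DiassociativeSemigroup.ra α β) γ)
          + leftComb k (prec α β) (succ (DiassociativeSemigroup.la α β) γ)))

open TwoParamOp in
/-- The defining relations of two-parameter duplicial algebras:
* `(x ≺_{α,β} y) ≺_{α←β,γ} z = x ≺_{α,β←γ} (y ≺_{β,γ} z)`,
* `(x ≻_{α,β} y) ≺_{α→β,γ} z = x ≻_{α,β←γ} (y ≺_{β,γ} z)`,
* `x ≻_{α,β→γ} (y ≻_{β,γ} z) = (x ≻_{α,β} y) ≻_{α→β,γ} z`. -/
inductive DupRel (k : Type u) [Field k] (Ω : Type v) [DuplicialSemigroup Ω] :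
    ∀ n, (Free k Ω).obj n → Prop
  | prec (α β γ : Ω) : DupRel k Ω 3
      (leftComb k (prec α β) (prec (DuplicialSemigroup.la α β) γ)
        - rightComb k (prec α (DuplicialSemigroup.la β γ)) (prec β γ))
  | mid (α β γ : Ω) : DupRel k Ω 3
      (leftComb k (succ α β) (prec (DuplicialSemigroup.ra α β) γ)
        - rightComb k (succ α (DuplicialSemigroup.la β γ)) (prec β γ))
  | succ (α β γ : Ω) : DupRel k Ω 3
      (rightComb k (succ α (DuplicialSemigroup.ra β γ)) (succ β γ)
        - leftComb k (succ α β) (succ (DuplicialSemigroup.ra α β) γ))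

/-- The non-symmetric operad of two-parameter `Ω`-dendriform algebras. -/
noncomputable def Dend2 (k : Type u) [Field k] (Ω : Type v) [DiassociativeSemigroup Ω] :
    NSOperad.{u, max u v} k :=
  (TwoParamOp.Free k Ω).quotient
    ((TwoParamOp.Free k Ω).idealSpan fun n => {x | DendRel k Ω n x})

/-- The non-symmetric operad of two-parameter `Ω`-duplicial algebras. -/
noncomputable def Dup2 (k : Type u) [Field k] (Ω : Type v) [DuplicialSemigroup Ω] :
    NSOperad.{u, max u v} k :=
  (TwoParamOp.Free k Ω).quotient
    ((TwoParamOp.Free k Ω).idealSpan fun n => {x | DupRel k Ω n x})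

/-- Two products on the parameters together with a scalar `c`, so that the rewriting rules of
two-parameter dendriform algebras (`c = 1`) and of two-parameter duplicial algebras (`c = 0`) are
treated together. -/
structure ParamData (k : Type u) [Field k] (Ω : Type v) where
  la : Ω → Ω → Ω
  ra : Ω → Ω → Ω
  c : k
  la_assoc : ∀ α β γ, la (la α β) γ = la α (la β γ)
  ra_la : ∀ α β γ, la (ra α β) γ = ra α (la β γ)
  ra_assoc : ∀ α β γ, ra (ra α β) γ = ra α (ra β γ)
  -- The two extra diassociative identities only serve to match the parameters of terms carrying the
  -- factor `c`, so none is required when `c = 0`.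
  diassociative : c = 0 ∨ c = 1 ∧ (∀ α β γ, la α (ra β γ) = la α (la β γ)) ∧
    ∀ α β γ, ra (la α β) γ = ra (ra α β) γ

/-- Linear combinations of decorated trees of all arities. -/
abbrev TreeSpace (k : Type u) [Field k] (Ω : Type v) := BinTree (TwoParamOp Ω) →₀ k

/-! ### Operations on trees defined by rewriting. -/

namespace ParamData

open TwoParamOp BinTree

variable {k : Type u} [Field k] {Ω : Type v}

/-- The bilinear extension of `BinTree.node g`. -/
noncomputable def nodeL (k : Type u) [Field k] {Ω : Type v} (g : TwoParamOp Ω) :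
    TreeSpace k Ω →ₗ[k] TreeSpace k Ω →ₗ[k] TreeSpace k Ω :=
  Finsupp.linearCombination k fun l => Finsupp.lmapDomain k k (node g l)

theorem nodeL_single (g : TwoParamOp Ω) (s t : BinTree (TwoParamOp Ω)) (a b : k) :
    nodeL k g (Finsupp.single s a) (Finsupp.single t b) = Finsupp.single (node g s t) (a * b) := by
  simp [nodeL, Finsupp.linearCombination_single, Finsupp.mapDomain_single]

variable (D : ParamData k Ω)

/-- The pattern at the root of `node g l r` is not the left-hand side of a rewriting rule. -/
def RootNormal : TwoParamOp Ω → BinTree (TwoParamOp Ω) → BinTree (TwoParamOp Ω) → Prop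
  | prec _ _, leaf, _ => True
  | prec δ _, node (prec α β) _ _, _ => D.la α β ≠ δ
  | prec δ _, node (succ α β) _ _, _ => D.ra α β ≠ δ
  | succ _ _, _, leaf => True
  | succ _ _, _, node (prec _ _) _ _ => True
  | succ _ δ, _, node (succ β γ) _ _ => D.ra β γ ≠ δ

open Classical in
/-- The operation `g` on trees, computed by rewriting. -/
noncomputable def op : TwoParamOp Ω → BinTree (TwoParamOp Ω) → BinTree (TwoParamOp Ω) →
    TreeSpace k Ω
  | prec δ γ, leaf, B => Finsupp.single (node (prec δ γ) leaf B) 1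
  | prec δ γ, node (prec α β) A₁ A₂, B =>
    if D.la α β = δ then
      nodeL k (prec α (D.la β γ)) (Finsupp.single A₁ 1) (op (prec β γ) A₂ B) +
        D.c • nodeL k (prec α (D.ra β γ)) (Finsupp.single A₁ 1) (op (succ β γ) A₂ B)
    else Finsupp.single (node (prec δ γ) (node (prec α β) A₁ A₂) B) 1
  | prec δ γ, node (succ α β) A₁ A₂, B =>
    if D.ra α β = δ then
      nodeL k (succ α (D.la β γ)) (Finsupp.single A₁ 1) (op (prec β γ) A₂ B)
    else Finsupp.single (node (prec δ γ) (node (succ α β) A₁ A₂) B) 1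
  | succ α δ, A, leaf => Finsupp.single (node (succ α δ) A leaf) 1
  | succ α δ, A, node (prec β γ) B₁ B₂ =>
    Finsupp.single (node (succ α δ) A (node (prec β γ) B₁ B₂)) 1
  | succ α δ, A, node (succ β γ) B₁ B₂ =>
    if D.ra β γ = δ then
      nodeL k (succ (D.ra α β) γ) (op (succ α β) A B₁) (Finsupp.single B₂ 1) +
        D.c • nodeL k (succ (D.la α β) γ) (op (prec α β) A B₁) (Finsupp.single B₂ 1)
    else Finsupp.single (node (succ α δ) A (node (succ β γ) B₁ B₂)) 1
-- A `≺` rule shrinks `A` and a `≻` rule shrinks `B`, but each may call the other operation, so only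
-- the sum serves as a measure.
termination_by _ A B => sizeOf A + sizeOf B

theorem op_of_rootNormal {g : TwoParamOp Ω} {A B : BinTree (TwoParamOp Ω)}
    (h : D.RootNormal g A B) : D.op g A B = Finsupp.single (node g A B) 1 := by
  unfold RootNormal at h
  split at h <;> simp_all [op]

/-- The bilinear extension of `op g`. -/
noncomputable def opL (g : TwoParamOp Ω) :
    TreeSpace k Ω →ₗ[k] TreeSpace k Ω →ₗ[k] TreeSpace k Ω :=
  Finsupp.linearCombination k fun A => Finsupp.linearCombination k (D.op g A)

theorem opL_single (g : TwoParamOp Ω) (s t : BinTree (TwoParamOp Ω)) (a b : k) :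
    D.opL g (Finsupp.single s a) (Finsupp.single t b) = (a * b) • D.op g s t := by
  simp [opL, Finsupp.linearCombination_single, mul_smul]

/-- Two trilinear maps that agree on trees are equal. -/
theorem trilinear_ext {M : Type*} [AddCommGroup M] [Module k M]
    {f g : TreeSpace k Ω →ₗ[k] TreeSpace k Ω →ₗ[k] TreeSpace k Ω →ₗ[k] M}
    (h : ∀ A B C, f (Finsupp.single A 1) (Finsupp.single B 1) (Finsupp.single C 1) =
      g (Finsupp.single A 1) (Finsupp.single B 1) (Finsupp.single C 1)) : f = g := by
  ext A B C : 6
  simpa using h A B C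

/-- `(x, y, z) ↦ f (g x y) z` -/
noncomputable def leftTri (f g : TreeSpace k Ω →ₗ[k] TreeSpace k Ω →ₗ[k] TreeSpace k Ω) :
    TreeSpace k Ω →ₗ[k] TreeSpace k Ω →ₗ[k] TreeSpace k Ω →ₗ[k] TreeSpace k Ω :=
  (LinearMap.compRight k f).comp g

/-- `(x, y, z) ↦ f x (g y z)` -/
noncomputable def rightTri (f g : TreeSpace k Ω →ₗ[k] TreeSpace k Ω →ₗ[k] TreeSpace k Ω) :
    TreeSpace k Ω →ₗ[k] TreeSpace k Ω →ₗ[k] TreeSpace k Ω →ₗ[k] TreeSpace k Ω :=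
  ((LinearMap.llcomp k (TreeSpace k Ω) (TreeSpace k Ω →ₗ[k] TreeSpace k Ω)
    (TreeSpace k Ω →ₗ[k] TreeSpace k Ω)).flip g).comp ((LinearMap.llcomp k _ _ _).comp f)

@[simp] theorem leftTri_apply (f g : TreeSpace k Ω →ₗ[k] TreeSpace k Ω →ₗ[k] TreeSpace k Ω)
    (x y z : TreeSpace k Ω) : leftTri f g x y z = f (g x y) z := rfl

@[simp] theorem rightTri_apply (f g : TreeSpace k Ω →ₗ[k] TreeSpace k Ω →ₗ[k] TreeSpace k Ω)
    (x y z : TreeSpace k Ω) : rightTri f g x y z = f x (g y z) := rfl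

/-- With a free product `nodeL` as inner operation, the matching clause of `op` applies to every
triple of trees, hence trilinearly. This lemma and the next three are the computation rules of the
tree algebra. -/
theorem opL_prec_nodeL_prec (α β γ : Ω) (x y z : TreeSpace k Ω) :
    D.opL (prec (D.la α β) γ) (nodeL k (prec α β) x y) z =
      nodeL k (prec α (D.la β γ)) x (D.opL (prec β γ) y z) +
        D.c • nodeL k (prec α (D.ra β γ)) x (D.opL (succ β γ) y z) := by
  have : leftTri (D.opL (prec (D.la α β) γ)) (nodeL k (prec α β)) =
      rightTri (nodeL k (prec α (D.la β γ))) (D.opL (prec β γ)) +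
        D.c • rightTri (nodeL k (prec α (D.ra β γ))) (D.opL (succ β γ)) :=
    trilinear_ext fun A B C => by simp [nodeL_single, opL_single, op]
  simpa using congr($this x y z)

theorem opL_prec_nodeL_succ (α β γ : Ω) (x y z : TreeSpace k Ω) :
    D.opL (prec (D.ra α β) γ) (nodeL k (succ α β) x y) z =
      nodeL k (succ α (D.la β γ)) x (D.opL (prec β γ) y z) := by
  have : leftTri (D.opL (prec (D.ra α β) γ)) (nodeL k (succ α β)) =
      rightTri (nodeL k (succ α (D.la β γ))) (D.opL (prec β γ)) :=
    trilinear_ext fun A B C => by simp [nodeL_single, opL_single, op]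
  simpa using congr($this x y z)

theorem opL_succ_nodeL_succ (α β γ : Ω) (x y z : TreeSpace k Ω) :
    D.opL (succ α (D.ra β γ)) x (nodeL k (succ β γ) y z) =
      nodeL k (succ (D.ra α β) γ) (D.opL (succ α β) x y) z +
        D.c • nodeL k (succ (D.la α β) γ) (D.opL (prec α β) x y) z := by
  have : rightTri (D.opL (succ α (D.ra β γ))) (nodeL k (succ β γ)) =
      leftTri (nodeL k (succ (D.ra α β) γ)) (D.opL (succ α β)) +
        D.c • leftTri (nodeL k (succ (D.la α β) γ)) (D.opL (prec α β)) :=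
    trilinear_ext fun A B C => by simp [nodeL_single, opL_single, op]
  simpa using congr($this x y z)

theorem opL_succ_nodeL_prec (α β γ δ : Ω) (x y z : TreeSpace k Ω) :
    D.opL (succ α δ) x (nodeL k (prec β γ) y z) =
      nodeL k (succ α δ) x (nodeL k (prec β γ) y z) := by
  have : rightTri (D.opL (succ α δ)) (nodeL k (prec β γ)) =
      rightTri (nodeL k (succ α δ)) (nodeL k (prec β γ)) :=
    trilinear_ext fun A B C => by simp [nodeL_single, opL_single, op]
  simpa using congr($this x y z)

/-- Normality at a `≺` root involves only its first parameter and its left subtree, so the second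
parameter and the right argument may be changed freely. -/
theorem opL_prec_of_rootNormal {δ γ : Ω} {A B : BinTree (TwoParamOp Ω)}
    (h : D.RootNormal (prec δ γ) A B) (δ' : Ω) (x : TreeSpace k Ω) :
    D.opL (prec δ δ') (Finsupp.single A 1) x = nodeL k (prec δ δ') (Finsupp.single A 1) x := by
  suffices D.opL (prec δ δ') (Finsupp.single A 1) = nodeL k (prec δ δ') (Finsupp.single A 1) from
    congr($this x)
  ext C : 2
  have : D.RootNormal (prec δ δ') A C := by
    revert h
    rcases A with _ | ⟨_ | _, _, _⟩ <;> simp [RootNormal]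
  simp [nodeL_single, opL_single, op_of_rootNormal D this]

theorem opL_succ_of_rootNormal {δ γ : Ω} {A B : BinTree (TwoParamOp Ω)}
    (h : D.RootNormal (succ γ δ) A B) (δ' : Ω) (x : TreeSpace k Ω) :
    D.opL (succ δ' δ) x (Finsupp.single B 1) = nodeL k (succ δ' δ) x (Finsupp.single B 1) := by
  suffices (D.opL (succ δ' δ)).flip (Finsupp.single B 1) =
    (nodeL k (succ δ' δ)).flip (Finsupp.single B 1) from congr($this x)
  ext C : 2
  have : D.RootNormal (succ δ' δ) C B := by
    revert h
    rcases B with _ | ⟨_ | _, _, _⟩ <;> simp [RootNormal]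
  simp [nodeL_single, opL_single, op_of_rootNormal D this]

theorem op_eq_opL (g : TwoParamOp Ω) (A B : BinTree (TwoParamOp Ω)) :
    D.op g A B = D.opL g (Finsupp.single A 1) (Finsupp.single B 1) := by
  simp [opL_single]

theorem single_node (g : TwoParamOp Ω) (A B : BinTree (TwoParamOp Ω)) :
    (Finsupp.single (node g A B) 1 : TreeSpace k Ω) =
      nodeL k g (Finsupp.single A 1) (Finsupp.single B 1) := by
  simp [nodeL_single]

/-! ### The tree algebra satisfies the defining relations. -/

/-- The relations of a `D`-algebra for given elements `x, y, z`. -/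
def Relations (x y z : TreeSpace k Ω) : Prop := ∀ α β γ : Ω,
  D.opL (prec (D.la α β) γ) (D.opL (prec α β) x y) z =
      D.opL (prec α (D.la β γ)) x (D.opL (prec β γ) y z) +
        D.c • D.opL (prec α (D.ra β γ)) x (D.opL (succ β γ) y z) ∧
  D.opL (prec (D.ra α β) γ) (D.opL (succ α β) x y) z =
      D.opL (succ α (D.la β γ)) x (D.opL (prec β γ) y z) ∧
  D.opL (succ α (D.ra β γ)) x (D.opL (succ β γ) y z) =
      D.opL (succ (D.ra α β) γ) (D.opL (succ α β) x y) z +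
        D.c • D.opL (succ (D.la α β) γ) (D.opL (prec α β) x y) z

/-- No induction is needed. If `A ≻ B` is normal at the root, then all trees in `B ≺ C` have a `≺`
root and `A ≻ (B ≺ C)` is a free product as well. Otherwise `B = B₁ ≻ B₂`, and both sides reduce to
products of `A ≻ B₁` and `A ≺ B₁` with `B₂ ≺ C`. -/
theorem relation_mid (A B C : BinTree (TwoParamOp Ω)) (α β γ : Ω) :
    D.opL (prec (D.ra α β) γ) (D.opL (succ α β) (Finsupp.single A 1) (Finsupp.single B 1))
        (Finsupp.single C 1) =
      D.opL (succ α (D.la β γ)) (Finsupp.single A 1)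
        (D.opL (prec β γ) (Finsupp.single B 1) (Finsupp.single C 1)) := by
  by_cases hB : D.RootNormal (succ α β) A B
  · rw [opL_succ_of_rootNormal D hB, opL_prec_nodeL_succ]
    rcases B with _ | ⟨⟨β₁, β₂⟩ | ⟨β₁, β₂⟩, B₁, B₂⟩
    · rw [opL_prec_of_rootNormal D (B := C) (γ := γ) (by simp [RootNormal]), opL_succ_nodeL_prec]
    · by_cases h : D.la β₁ β₂ = β
      · subst h
        rw [single_node, opL_prec_nodeL_prec, map_add, map_add, map_smul, map_smul,
          opL_succ_nodeL_prec, opL_succ_nodeL_prec]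
      · rw [opL_prec_of_rootNormal D (B := C) (γ := γ) (by simpa [RootNormal]),
          opL_succ_nodeL_prec]
    · rw [opL_prec_of_rootNormal D (B := C) (γ := γ) (by simpa [RootNormal] using hB),
          opL_succ_nodeL_prec]
  · rcases B with _ | ⟨⟨β₁, β₂⟩ | ⟨β₁, β₂⟩, B₁, B₂⟩
    · simp [RootNormal] at hB
    · simp [RootNormal] at hB
    · simp only [RootNormal, ne_eq, not_not] at hB
      subst hB
      rw [single_node, opL_succ_nodeL_succ, opL_prec_nodeL_succ, D.ra_la, opL_succ_nodeL_succ,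
        map_add, LinearMap.add_apply, map_smul, LinearMap.smul_apply, ← D.ra_assoc,
        opL_prec_nodeL_succ]
      rcases D.diassociative with h | ⟨-, -, h⟩
      · simp [h]
      · rw [← h, opL_prec_nodeL_succ]

/-- If `A ≺ B` is normal at the root, the relation is the rewriting rule itself. Otherwise the rules
push `B` and `C` into the right subtree `A₂` of `A`, and the relations for `A₂, B, C` conclude. -/
theorem relation_prec (A B C : BinTree (TwoParamOp Ω))
    (ih : ∀ g A₁ A₂, A = node g A₁ A₂ →
      D.Relations (Finsupp.single A₂ 1) (Finsupp.single B 1) (Finsupp.single C 1))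
    (α β γ : Ω) :
    D.opL (prec (D.la α β) γ) (D.opL (prec α β) (Finsupp.single A 1) (Finsupp.single B 1))
        (Finsupp.single C 1) =
      D.opL (prec α (D.la β γ)) (Finsupp.single A 1)
          (D.opL (prec β γ) (Finsupp.single B 1) (Finsupp.single C 1)) +
        D.c • D.opL (prec α (D.ra β γ)) (Finsupp.single A 1)
          (D.opL (succ β γ) (Finsupp.single B 1) (Finsupp.single C 1)) := by
  by_cases hA : D.RootNormal (prec α β) A B
  · simp only [opL_prec_of_rootNormal D hA, opL_prec_nodeL_prec]
  · rcases A with _ | ⟨⟨α₁, α₂⟩ | ⟨α₁, α₂⟩, A₁, A₂⟩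
    · simp [RootNormal] at hA
    · simp only [RootNormal, ne_eq, not_not] at hA
      subst hA
      obtain ⟨h₁, h₂, h₃⟩ := ih _ _ _ rfl α₂ β γ
      rw [single_node, opL_prec_nodeL_prec, opL_prec_nodeL_prec, opL_prec_nodeL_prec,
        map_add, LinearMap.add_apply, map_smul, LinearMap.smul_apply, D.la_assoc,
        opL_prec_nodeL_prec, h₃, h₁]
      rcases D.diassociative with h | ⟨hc, h, h'⟩
      · simp [h, D.la_assoc]
      -- The rule applies to the term containing `A₂ ≻ B` only if the outer parameter is written `α₁
      -- ← (α₂ → β)`. The diassociative identity supplies this form; for `c = 0` the term is absent.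
      · rw [← h α₁, opL_prec_nodeL_prec, h₂]
        simp only [D.la_assoc, D.ra_la, D.ra_assoc, hc, one_smul, h, h', map_add]
        abel
    · simp only [RootNormal, ne_eq, not_not] at hA
      subst hA
      obtain ⟨h₁, h₂, h₃⟩ := ih _ _ _ rfl α₂ β γ
      rw [single_node, opL_prec_nodeL_succ, opL_prec_nodeL_succ, opL_prec_nodeL_succ,
        D.ra_la, opL_prec_nodeL_succ, h₁]
      rcases D.diassociative with h | ⟨-, h, -⟩
      · simp [h, D.la_assoc]
      · simp only [D.la_assoc, h, map_add, map_smul]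

/-- Mirror image of `relation_prec`: `A` and `B` are pushed into the left subtree of `C`. -/
theorem relation_succ (A B C : BinTree (TwoParamOp Ω))
    (ih : ∀ g C₁ C₂, C = node g C₁ C₂ →
      D.Relations (Finsupp.single A 1) (Finsupp.single B 1) (Finsupp.single C₁ 1))
    (α β γ : Ω) :
    D.opL (succ α (D.ra β γ)) (Finsupp.single A 1)
        (D.opL (succ β γ) (Finsupp.single B 1) (Finsupp.single C 1)) =
      D.opL (succ (D.ra α β) γ)
          (D.opL (succ α β) (Finsupp.single A 1) (Finsupp.single B 1)) (Finsupp.single C 1) +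
        D.c • D.opL (succ (D.la α β) γ)
          (D.opL (prec α β) (Finsupp.single A 1) (Finsupp.single B 1)) (Finsupp.single C 1) := by
  by_cases hC : D.RootNormal (succ β γ) B C
  · simp only [opL_succ_of_rootNormal D hC, opL_succ_nodeL_succ]
  · rcases C with _ | ⟨⟨γ₁, γ₂⟩ | ⟨γ₁, γ₂⟩, C₁, C₂⟩
    · simp [RootNormal] at hC
    · simp [RootNormal] at hC
    · simp only [RootNormal, ne_eq, not_not] at hC
      subst hC
      obtain ⟨h₁, h₂, h₃⟩ := ih _ _ _ rfl α β γ₁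
      rw [single_node, opL_succ_nodeL_succ, opL_succ_nodeL_succ, opL_succ_nodeL_succ,
        map_add, map_smul, ← D.ra_assoc, opL_succ_nodeL_succ, h₁, h₃]
      rcases D.diassociative with h | ⟨hc, h', h⟩
      · simp [h, D.ra_assoc]
      · rw [← h β, opL_succ_nodeL_succ, ← h₂]
        simp only [D.la_assoc, D.ra_la, D.ra_assoc, hc, one_smul, h, h', map_add,
          LinearMap.add_apply]
        abel

/-- The middle tree stays fixed in the induction: the first relation shrinks `A`, the third shrinks
`C`. -/
theorem relations_single (A B C : BinTree (TwoParamOp Ω)) :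
    D.Relations (Finsupp.single A 1) (Finsupp.single B 1) (Finsupp.single C 1) := by
  induction h : sizeOf A + sizeOf C using Nat.strong_induction_on generalizing A C with
  | _ n ih =>
    subst h
    refine fun α β γ => ⟨relation_prec D A B C ?_ α β γ, relation_mid D A B C α β γ,
      relation_succ D A B C ?_ α β γ⟩
    · rintro g A₁ A₂ rfl
      exact ih _ (by simp) _ _ rfl
    · rintro g C₁ C₂ rfl
      exact ih _ (by simp; omega) _ _ rfl

theorem relations (x y z : TreeSpace k Ω) : D.Relations x y z := by
  intro α β γ
  refine ⟨?_, ?_, ?_⟩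
  · have : leftTri (D.opL (prec (D.la α β) γ)) (D.opL (prec α β)) =
        rightTri (D.opL (prec α (D.la β γ))) (D.opL (prec β γ)) +
        D.c • rightTri (D.opL (prec α (D.ra β γ))) (D.opL (succ β γ)) :=
      trilinear_ext fun A B C => (relations_single D A B C α β γ).1
    exact congr($this x y z)
  · have : leftTri (D.opL (prec (D.ra α β) γ)) (D.opL (succ α β)) =
        rightTri (D.opL (succ α (D.la β γ))) (D.opL (prec β γ)) :=
      trilinear_ext fun A B C => (relations_single D A B C α β γ).2.1
    exact congr($this x y z)
  · have : rightTri (D.opL (succ α (D.ra β γ))) (D.opL (succ β γ)) =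
        leftTri (D.opL (succ (D.ra α β) γ)) (D.opL (succ α β)) +
        D.c • leftTri (D.opL (succ (D.la α β) γ)) (D.opL (prec α β)) :=
      trilinear_ext fun A B C => (relations_single D A B C α β γ).2.2
    exact congr($this x y z)

end ParamData

/-! ### Evaluation of the free operad in the tree algebra. -/

namespace ParamData

open TwoParamOp BinTree

variable {k : Type u} [Field k] {Ω : Type v} (D : ParamData k Ω)

/-- Evaluation of a tree as an operation, at the inputs `a 0, a 1, …`. -/
noncomputable def ev : BinTree (TwoParamOp Ω) → (ℕ → TreeSpace k Ω) → TreeSpace k Ω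
  | leaf, a => a 0
  | node g l r, a => D.opL g (ev l a) (ev r fun i => a (i + l.leaves))

theorem ev_congr (s : BinTree (TwoParamOp Ω)) {a b : ℕ → TreeSpace k Ω}
    (h : ∀ i < s.leaves, a i = b i) : D.ev s a = D.ev s b := by
  induction s generalizing a b with
  | leaf => exact h 0 (by simp [leaves])
  | node g l r ihl ihr =>
    simp only [leaves] at h
    simp only [ev]
    rw [ihl fun i hi => h i (by omega), ihr fun i hi => h _ (by omega)]

/-- Grafting is substitution: input `i` of `s` receives the value of `t`, and the inputs beyond `i`
are shifted past the leaves of `t`. -/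
theorem ev_graft (s t : BinTree (TwoParamOp Ω)) (i : ℕ) (hi : i < s.leaves)
    (a : ℕ → TreeSpace k Ω) :
    D.ev (graft s i t) a = D.ev s (Function.update
      (fun j => if j < i then a j else a (j + t.leaves - 1)) i
        (D.ev t fun j => a (j + i))) := by
  induction s generalizing i a with
  | leaf =>
    obtain rfl : i = 0 := by simpa [leaves] using hi
    simp [graft, ev]
  | node g l r ihl ihr =>
    simp only [leaves] at hi
    by_cases h : i < l.leaves
    · have h1 := leaves_graft l t i h
      simp only [graft, if_pos h, ev]
      rw [ihl i h]
      congr 1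
      refine ev_congr D r fun j _ => ?_
      rw [Function.update_of_ne (by omega), if_neg (by omega)]
      congr 1
      omega
    · simp only [graft, if_neg h, ev]
      rw [ihr _ (by omega)]
      congr 1
      · congr 1
        refine ev_congr D l fun j _ => ?_
        rw [Function.update_of_ne (by omega), if_pos (by omega)]
      · refine ev_congr D r fun j _ => ?_
        by_cases hj : j = i - l.leaves
        · subst hj
          rw [Nat.sub_add_cancel (by omega), Function.update_self, Function.update_self]
          refine ev_congr D t fun m _ => ?_
          congr 1
          omega
        · rw [Function.update_of_ne hj, Function.update_of_ne (by omega)]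
          by_cases hj' : j < i - l.leaves
          · rw [if_pos hj', if_pos (by omega)]
          · rw [if_neg hj', if_neg (by omega)]
            congr 1
            omega

/-- Multilinearity of evaluation, needed for `evIdeal` to absorb compositions whose inner operation
vanishes. -/
theorem exists_linear_ev_update (s : BinTree (TwoParamOp Ω)) (a : ℕ → TreeSpace k Ω) (i : ℕ)
    (hi : i < s.leaves) :
    ∃ L : TreeSpace k Ω →ₗ[k] TreeSpace k Ω, ∀ v, D.ev s (Function.update a i v) = L v := by
  induction s generalizing i a with
  | leaf =>
    obtain rfl : i = 0 := by simpa [leaves] using hi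
    exact ⟨LinearMap.id, fun v => by simp [ev]⟩
  | node g l r ihl ihr =>
    simp only [leaves] at hi
    by_cases h : i < l.leaves
    · obtain ⟨L, hL⟩ := ihl a i h
      refine ⟨((D.opL g).flip (D.ev r fun i => a (i + l.leaves))).comp L, fun v => ?_⟩
      simp only [ev, hL, LinearMap.comp_apply, LinearMap.flip_apply]
      congr 1
      exact ev_congr D r fun j _ => Function.update_of_ne (by omega) _ _
    · obtain ⟨L, hL⟩ := ihr (fun j => a (j + l.leaves)) (i - l.leaves) (by omega)
      refine ⟨(D.opL g (D.ev l a)).comp L, fun v => ?_⟩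
      simp only [ev, LinearMap.comp_apply, ← hL]
      congr 1
      · congr 1
        exact ev_congr D l fun j _ => Function.update_of_ne (by omega) _ _
      · refine ev_congr D r fun j _ => ?_
        by_cases hj : j = i - l.leaves
        · subst hj
          rw [Nat.sub_add_cancel (by omega), Function.update_self, Function.update_self]
        · rw [Function.update_of_ne hj, Function.update_of_ne (by omega)]

/-- A multiple of a tree, as an element of the free operad. -/
noncomputable def freeSingle {n : ℕ} (t : BinTreeN (TwoParamOp Ω) n) (b : k) :
    (Free k Ω).obj n :=
  (Finsupp.single t b : BinTreeN (TwoParamOp Ω) n →₀ k)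

/-- Evaluation of an element of the free operad. -/
noncomputable def evL (n : ℕ) (a : ℕ → TreeSpace k Ω) : (Free k Ω).obj n →ₗ[k] TreeSpace k Ω :=
  Finsupp.linearCombination k fun t : BinTreeN (TwoParamOp Ω) n => D.ev t.1 a

theorem evL_single (n : ℕ) (a : ℕ → TreeSpace k Ω) (t : BinTreeN (TwoParamOp Ω) n) (b : k) :
    D.evL n a (freeSingle t b) = b • D.ev t.1 a :=
  Finsupp.linearCombination_single _ _ _

theorem free_comp_single {m n p : ℕ} (h : p + 1 = m + n) (i : Fin m)
    (s : BinTreeN (TwoParamOp Ω) m) (t : BinTreeN (TwoParamOp Ω) n) (a b : k) :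
    (Free k Ω).comp h i (freeSingle s a) (freeSingle t b) =
      freeSingle (BinTreeN.graft h i s t) (a * b) :=
  freeComp_single k _ h i s t a b

/-- Linear induction for elements of the free operad. -/
theorem free_induction {n : ℕ} {p : (Free k Ω).obj n → Prop} (x : (Free k Ω).obj n)
    (zero : p 0) (add : ∀ x y, p x → p y → p (x + y))
    (single : ∀ (t : BinTreeN (TwoParamOp Ω) n) (a : k),
      p (freeSingle t a)) : p x :=
  Finsupp.induction_linear (motive := p) x zero add single

/-- The ideal of operations that vanish identically on the tree algebra. -/
noncomputable def evIdeal : (Free k Ω).Ideal where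
  carrier n := ⨅ a : ℕ → TreeSpace k Ω, LinearMap.ker (D.evL n a)
  comp_left_mem {m n p} h i x y hx := by
    simp only [Submodule.mem_iInf, LinearMap.mem_ker] at hx ⊢
    intro a
    induction y using free_induction with
    | zero => simp
    | add y z hy hz => rw [map_add, map_add, hy, hz, add_zero]
    | single t b =>
      -- The vanishing of `x` is used at the inputs prescribed by `ev_graft`.
      rw [← smul_zero b, ← hx (Function.update
        (fun j => if j < (i : ℕ) then a j else a (j + n - 1)) i (D.ev t.1 fun j => a (j + i)))]
      clear hx
      induction x using free_induction with
      | zero => simp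
      | add y z hy hz => rw [map_add, LinearMap.add_apply, map_add, hy, hz, map_add, smul_add]
      | single s c =>
        rw [free_comp_single, evL_single, evL_single, BinTreeN.graft,
          ev_graft _ _ _ _ (by rw [s.2]; exact i.2), t.2, smul_smul, mul_comm]
  comp_right_mem {m n p} h i x y hy := by
    simp only [Submodule.mem_iInf, LinearMap.mem_ker] at hy ⊢
    intro a
    induction x using free_induction with
    | zero => rw [map_zero, LinearMap.zero_apply, map_zero]
    | add y z hy hz => rw [map_add, LinearMap.add_apply, map_add, hy, hz, add_zero]
    | single s c =>
      obtain ⟨L, hL⟩ := D.exists_linear_ev_update s.1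
        (fun j => if j < (i : ℕ) then a j else a (j + n - 1)) i (by rw [s.2]; exact i.2)
      suffices ∀ y, D.evL p a ((Free k Ω).comp h i (freeSingle s c) y) =
          c • L (D.evL n (fun j => a (j + i)) y) by rw [this, hy, map_zero, smul_zero]
      intro y
      induction y using free_induction with
      | zero => simp
      | add y z hy hz => rw [map_add, map_add, hy, hz, map_add, map_add, smul_add]
      | single t b =>
        rw [free_comp_single, evL_single, evL_single, BinTreeN.graft,
          ev_graft _ _ _ _ (by rw [s.2]; exact i.2), t.2, hL, map_smul, smul_smul]

/-- The defining relations of `D`-algebras. -/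
inductive Rel : ∀ n, (Free k Ω).obj n → Prop
  | prec (α β γ : Ω) : Rel 3
      (leftComb k (prec α β) (prec (D.la α β) γ) - (rightComb k (prec α (D.la β γ)) (prec β γ)
          + D.c • rightComb k (prec α (D.ra β γ)) (succ β γ)))
  | mid (α β γ : Ω) : Rel 3
      (leftComb k (succ α β) (prec (D.ra α β) γ) - rightComb k (succ α (D.la β γ)) (prec β γ))
  | succ (α β γ : Ω) : Rel 3
      (rightComb k (succ α (D.ra β γ)) (succ β γ) - (leftComb k (succ α β) (succ (D.ra α β) γ)
          + D.c • leftComb k (prec α β) (succ (D.la α β) γ)))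

/-- The ideal generated by the defining relations. -/
noncomputable def relIdeal : (Free k Ω).Ideal := (Free k Ω).idealSpan fun n => {x | D.Rel n x}

theorem gen_eq (a : TwoParamOp Ω) : gen k a = freeSingle (n := 2) ⟨node a leaf leaf, rfl⟩ 1 := rfl

theorem leftComb_eq (a b : TwoParamOp Ω) : leftComb k a b =
    freeSingle (n := 3) ⟨node b (node a leaf leaf) leaf, rfl⟩ 1 := by
  rw [leftComb, gen_eq, gen_eq, free_comp_single, mul_one]
  rfl

theorem rightComb_eq (a b : TwoParamOp Ω) : rightComb k a b =
    freeSingle (n := 3) ⟨node a leaf (node b leaf leaf), rfl⟩ 1 := by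
  rw [rightComb, gen_eq, gen_eq, free_comp_single, mul_one]
  rfl

/-- By `relations`, `evIdeal` is one of the ideals whose infimum is the generated ideal. -/
theorem relIdeal_le_evIdeal (n : ℕ) : D.relIdeal.carrier n ≤ D.evIdeal.carrier n := by
  have key : ∀ m, {x | D.Rel m x} ⊆ (D.evIdeal.carrier m : Set ((Free k Ω).obj m)) := by
    rintro m x hx
    simp only [evIdeal, SetLike.mem_coe, Submodule.mem_iInf, LinearMap.mem_ker]
    intro a
    have hl : ∀ g h, D.evL 3 a (leftComb k g h) = D.opL h (D.opL g (a 0) (a 1)) (a 2) := by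
      intro g h
      rw [leftComb_eq, evL_single, one_smul]
      rfl
    have hr : ∀ g h, D.evL 3 a (rightComb k g h) = D.opL g (a 0) (D.opL h (a 1) (a 2)) := by
      intro g h
      rw [rightComb_eq, evL_single, one_smul]
      rfl
    rcases hx with ⟨α, β, γ⟩ | ⟨α, β, γ⟩ | ⟨α, β, γ⟩ <;>
      obtain ⟨h₁, h₂, h₃⟩ := D.relations (a 0) (a 1) (a 2) α β γ <;>
      simp only [map_sub, map_add, map_smul, hl, hr, h₁, h₂, h₃, sub_self]
  exact iInf_le (fun J : {J : (Free k Ω).Ideal // ∀ m, {x | D.Rel m x} ⊆ J.carrier m} =>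
    J.1.carrier n) ⟨D.evIdeal, key⟩

theorem rel_mem_relIdeal {n : ℕ} {x : (Free k Ω).obj n} (h : D.Rel n x) :
    x ∈ D.relIdeal.carrier n := by
  simp only [relIdeal, NSOperad.idealSpan, Submodule.mem_iInf]
  exact fun J => J.2 n h

/-! ### Every tree is congruent to its normal form. -/

/-- An element of the free operad as a combination of trees. -/
noncomputable def toTrees (k : Type u) [Field k] (Ω : Type v) (n : ℕ) :
    (Free k Ω).obj n →ₗ[k] TreeSpace k Ω :=
  Finsupp.lmapDomain k k (Subtype.val : BinTreeN (TwoParamOp Ω) n → BinTree (TwoParamOp Ω))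

theorem toTrees_single (n : ℕ) (t : BinTreeN (TwoParamOp Ω) n) (b : k) :
    toTrees k Ω n (freeSingle t b) = Finsupp.single t.1 b :=
  Finsupp.mapDomain_single

/-- The sum over all arities of the ideal generated by the relations. -/
noncomputable def relSpace : Submodule k (TreeSpace k Ω) :=
  ⨆ n, (D.relIdeal.carrier n).map (toTrees k Ω n)

theorem toTrees_mem_relSpace {n : ℕ} {x : (Free k Ω).obj n} (h : x ∈ D.relIdeal.carrier n) :
    toTrees k Ω n x ∈ D.relSpace :=
  Submodule.mem_iSup_of_mem n (Submodule.mem_map_of_mem h)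

/-- The component of arity `n`. -/
noncomputable def ofTrees (k : Type u) [Field k] (Ω : Type v) (n : ℕ) :
    TreeSpace k Ω →ₗ[k] (Free k Ω).obj n :=
  Finsupp.lsubtypeDomain {t : BinTree (TwoParamOp Ω) | t.leaves = n}

theorem ofTrees_toTrees (n : ℕ) (x : (Free k Ω).obj n) : ofTrees k Ω n (toTrees k Ω n x) = x := by
  induction x using free_induction with
  | zero => simp
  | add y z hy hz => rw [map_add, map_add, hy, hz]
  | single t b =>
    rw [toTrees_single]
    refine Finsupp.ext fun s => ?_
    change Finsupp.single t.1 b s.1 = Finsupp.single t b s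
    classical
    simp [Finsupp.single_apply, Subtype.ext_iff]

theorem ofTrees_toTrees_of_ne {m n : ℕ} (h : m ≠ n) (x : (Free k Ω).obj m) :
    ofTrees k Ω n (toTrees k Ω m x) = 0 := by
  induction x using free_induction with
  | zero => simp
  | add y z hy hz => rw [map_add, map_add, hy, hz, add_zero]
  | single t b =>
    rw [toTrees_single]
    refine Finsupp.ext fun s => ?_
    change Finsupp.single t.1 b s.1 = 0
    classical
    rw [Finsupp.single_apply, if_neg]
    intro hts
    exact h (by rw [← t.2, ← s.2, hts])

/-- `relSpace` is graded by the number of leaves. Congruences can thus be proved on trees of all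
arities at once and brought back to arity `n` by projection. -/
theorem toTrees_mem_relSpace_iff {n : ℕ} {x : (Free k Ω).obj n} :
    toTrees k Ω n x ∈ D.relSpace ↔ x ∈ D.relIdeal.carrier n := by
  refine ⟨fun h => ?_, D.toTrees_mem_relSpace⟩
  have : D.relSpace ≤ (D.relIdeal.carrier n).comap (ofTrees k Ω n) := by
    refine iSup_le fun m => ?_
    rintro _ ⟨y, hy, rfl⟩
    rw [Submodule.mem_comap]
    by_cases hmn : m = n
    · subst hmn
      rwa [ofTrees_toTrees]
    · rw [ofTrees_toTrees_of_ne hmn]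
      exact zero_mem _
  simpa [ofTrees_toTrees] using this h

theorem relSpace_nodeL_left (g : TwoParamOp Ω) {x : TreeSpace k Ω} (hx : x ∈ D.relSpace)
    (y : TreeSpace k Ω) : nodeL k g x y ∈ D.relSpace := by
  suffices D.relSpace ≤ D.relSpace.comap ((nodeL k g).flip y) from this hx
  refine iSup_le fun n => ?_
  rintro _ ⟨x, hx, rfl⟩
  rw [Submodule.mem_comap, LinearMap.flip_apply]
  induction y using Finsupp.induction_linear with
  | zero => simp
  | add y z hy hz => rw [map_add]; exact add_mem hy hz
  | single t b =>
    -- `node g x t` is `(g ∘₁ t) ∘₀ x`; filling the right input first leaves the index `0`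
    -- unchanged.
    have h := D.relIdeal.comp_right_mem (m := t.leaves + 1) (n := n) (p := n + t.leaves)
      (by omega) 0 ((Free k Ω).comp (m := 2) (n := t.leaves) (p := t.leaves + 1) (by omega) 1
        (gen k g) (freeSingle (n := t.leaves) ⟨t, rfl⟩ b)) x hx
    convert D.toTrees_mem_relSpace h using 1
    clear h hx
    induction x using free_induction with
    | zero => simp
    | add y z hy hz => simp only [map_add, LinearMap.add_apply, hy, hz]
    | single s c =>
      rw [gen_eq, free_comp_single, free_comp_single, toTrees_single, toTrees_single, nodeL_single,
        one_mul, mul_comm]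
      rfl

theorem relSpace_nodeL_right (g : TwoParamOp Ω) (x : TreeSpace k Ω) {y : TreeSpace k Ω}
    (hy : y ∈ D.relSpace) : nodeL k g x y ∈ D.relSpace := by
  suffices D.relSpace ≤ D.relSpace.comap (nodeL k g x) from this hy
  refine iSup_le fun n => ?_
  rintro _ ⟨y, hy, rfl⟩
  rw [Submodule.mem_comap]
  induction x using Finsupp.induction_linear with
  | zero => simp
  | add y z hy hz => rw [map_add]; exact add_mem hy hz
  | single t b =>
    have h := D.relIdeal.comp_right_mem (m := t.leaves + 1) (n := n) (p := t.leaves + n)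
      (by omega) (Fin.last _) ((Free k Ω).comp (m := 2) (n := t.leaves) (p := t.leaves + 1)
        (by omega) 0 (gen k g)
          (freeSingle (n := t.leaves) ⟨t, rfl⟩ b)) y hy
    convert D.toTrees_mem_relSpace h using 1
    clear h hy
    induction y using free_induction with
    | zero => simp
    | add y z hy hz => simp only [map_add, hy, hz]
    | single s c =>
      rw [gen_eq, free_comp_single, free_comp_single, toTrees_single, toTrees_single, nodeL_single,
        one_mul]
      simp [BinTreeN.graft, graft, leaves]

/-- `L` substitutes `A, B, C` into a ternary operation, from the last input to the first so that the
remaining inputs keep their numbers. -/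
theorem nodeL_rel_mem (A B C : BinTree (TwoParamOp Ω)) {ρ : (Free k Ω).obj 3} (h : D.Rel 3 ρ) :
    ∃ L : (Free k Ω).obj 3 →ₗ[k] TreeSpace k Ω, L ρ ∈ D.relSpace ∧
      (∀ a b, L (leftComb k a b) = Finsupp.single (node b (node a A B) C) 1) ∧
      ∀ a b, L (rightComb k a b) = Finsupp.single (node a A (node b B C)) 1 := by
  let L₂ : (Free k Ω).obj 3 →ₗ[k] (Free k Ω).obj (C.leaves + 2) :=
    ((Free k Ω).comp (m := 3) (n := C.leaves) (p := C.leaves + 2) (by omega) 2).flip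
      (freeSingle (n := C.leaves) ⟨C, rfl⟩ 1)
  let L₁ : (Free k Ω).obj (C.leaves + 2) →ₗ[k] (Free k Ω).obj (B.leaves + C.leaves + 1) :=
    ((Free k Ω).comp (m := C.leaves + 2) (n := B.leaves) (p := B.leaves + C.leaves + 1)
      (by omega) 1).flip (freeSingle (n := B.leaves) ⟨B, rfl⟩ 1)
  let L₀ : (Free k Ω).obj (B.leaves + C.leaves + 1) →ₗ[k]
      (Free k Ω).obj (A.leaves + B.leaves + C.leaves) :=
    ((Free k Ω).comp (m := B.leaves + C.leaves + 1) (n := A.leaves)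
      (p := A.leaves + B.leaves + C.leaves)
      (by omega) 0).flip (freeSingle (n := A.leaves) ⟨A, rfl⟩ 1)
  refine ⟨(toTrees k Ω _).comp (L₀.comp (L₁.comp L₂)), ?_, fun a b => ?_, fun a b => ?_⟩
  · exact D.toTrees_mem_relSpace (D.relIdeal.comp_left_mem _ _ _ _
      (D.relIdeal.comp_left_mem _ _ _ _ (D.relIdeal.comp_left_mem _ _ _ _
        (D.rel_mem_relIdeal h))))
  · simp only [LinearMap.comp_apply, L₀, L₁, L₂, LinearMap.flip_apply]
    rw [leftComb_eq, free_comp_single, free_comp_single, free_comp_single, toTrees_single]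
    simp [BinTreeN.graft, graft, leaves]
  · simp only [LinearMap.comp_apply, L₀, L₁, L₂, LinearMap.flip_apply]
    rw [rightComb_eq, free_comp_single, free_comp_single, free_comp_single, toTrees_single]
    simp [BinTreeN.graft, graft, leaves]

/-- The proof follows the recursion defining `op`: one rewriting at the root is an instance of a
relation, and the recursive calls take place under a node, which preserves `relSpace`. -/
theorem node_sub_op_mem (g : TwoParamOp Ω) (A B : BinTree (TwoParamOp Ω)) :
    Finsupp.single (node g A B) 1 - D.op g A B ∈ D.relSpace := by
  induction h : sizeOf A + sizeOf B using Nat.strong_induction_on generalizing g A B with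
  | _ n ih =>
  subst h
  by_cases hg : D.RootNormal g A B
  · simp [op_of_rootNormal D hg]
  rcases g with ⟨δ, γ⟩ | ⟨α, δ⟩
  · rcases A with _ | ⟨⟨α, β⟩ | ⟨α, β⟩, A₁, A₂⟩
    · simp [RootNormal] at hg
    · simp only [RootNormal, ne_eq, not_not] at hg
      subst hg
      obtain ⟨L, hL, hl, hr⟩ := D.nodeL_rel_mem A₁ A₂ B (Rel.prec α β γ)
      have h₁ := D.relSpace_nodeL_right (prec α (D.la β γ)) (Finsupp.single A₁ 1)
        (ih _ (by simp) (prec β γ) A₂ B rfl)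
      have h₂ := D.relSpace.smul_mem D.c
        (D.relSpace_nodeL_right (prec α (D.ra β γ)) (Finsupp.single A₁ 1)
        (ih _ (by simp) (succ β γ) A₂ B rfl))
      convert add_mem (add_mem hL h₁) h₂ using 1
      simp only [map_sub, map_add, map_smul, hl, hr, op, if_true, nodeL_single, mul_one]
      module
    · simp only [RootNormal, ne_eq, not_not] at hg
      subst hg
      obtain ⟨L, hL, hl, hr⟩ := D.nodeL_rel_mem A₁ A₂ B (Rel.mid α β γ)
      have h₁ := D.relSpace_nodeL_right (succ α (D.la β γ)) (Finsupp.single A₁ 1)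
        (ih _ (by simp) (prec β γ) A₂ B rfl)
      convert add_mem hL h₁ using 1
      simp only [map_sub, hl, hr, op, if_true, nodeL_single, mul_one]
      module
  · rcases B with _ | ⟨⟨β, γ⟩ | ⟨β, γ⟩, B₁, B₂⟩
    · simp [RootNormal] at hg
    · simp [RootNormal] at hg
    · simp only [RootNormal, ne_eq, not_not] at hg
      subst hg
      obtain ⟨L, hL, hl, hr⟩ := D.nodeL_rel_mem A B₁ B₂ (Rel.succ α β γ)
      have h₁ := D.relSpace_nodeL_left (succ (D.ra α β) γ)
        (ih _ (by simp; omega) (succ α β) A B₁ rfl) (Finsupp.single B₂ 1)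
      have h₂ := D.relSpace.smul_mem D.c (D.relSpace_nodeL_left (succ (D.la α β) γ)
        (ih _ (by simp; omega) (prec α β) A B₁ rfl) (Finsupp.single B₂ 1))
      convert add_mem (add_mem hL h₁) h₂ using 1
      simp only [map_sub, map_add, map_smul, hl, hr, op, if_true, nodeL_single, mul_one,
        LinearMap.sub_apply]
      module

theorem nodeL_sub_opL_mem (g : TwoParamOp Ω) (x y : TreeSpace k Ω) :
    nodeL k g x y - D.opL g x y ∈ D.relSpace := by
  suffices (nodeL k g).compr₂ D.relSpace.mkQ = (D.opL g).compr₂ D.relSpace.mkQ from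
    (Submodule.Quotient.eq _).1 congr($this x y)
  ext A B : 4
  simpa [nodeL_single, opL_single] using (Submodule.Quotient.eq _).2 (D.node_sub_op_mem g A B)

/-- The normal form of a tree. -/
noncomputable def nf (t : BinTree (TwoParamOp Ω)) : TreeSpace k Ω :=
  D.ev t fun _ => Finsupp.single leaf 1

theorem single_sub_nf_mem (t : BinTree (TwoParamOp Ω)) :
    Finsupp.single t 1 - D.nf t ∈ D.relSpace := by
  induction t with
  | leaf => simp [nf, ev]
  | node g l r ihl ihr =>
    have h₁ := D.relSpace_nodeL_left g ihl (Finsupp.single r 1)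
    have h₂ := D.relSpace_nodeL_right g (D.nf l) ihr
    have h₃ := D.nodeL_sub_opL_mem g (D.nf l) (D.nf r)
    convert add_mem (add_mem h₁ h₂) h₃ using 1
    simp only [map_sub, LinearMap.sub_apply, nodeL_single, mul_one]
    change _ - D.opL g (D.nf l) (D.nf r) = _
    abel

/-! ### Normal trees form a basis of the quotient operad. -/

/-- Trees to which no rewriting rule applies. -/
def Normal : BinTree (TwoParamOp Ω) → Prop
  | leaf => True
  | node g l r => D.RootNormal g l r ∧ Normal l ∧ Normal r

theorem nf_of_normal {t : BinTree (TwoParamOp Ω)} (h : D.Normal t) :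
    D.nf t = Finsupp.single t 1 := by
  induction t with
  | leaf => rfl
  | node g l r ihl ihr =>
    change D.opL g (D.nf l) (D.nf r) = _
    rw [ihl h.2.1, ihr h.2.2, ← op_eq_opL, op_of_rootNormal D h.1]

/-- The normal trees with `n` leaves. -/
def normalTrees (n : ℕ) : Set (BinTree (TwoParamOp Ω)) := {t | D.Normal t ∧ t.leaves = n}

/-- A property of bilinear maps that can be checked on trees. -/
theorem bilinear_mem_supported {f : TreeSpace k Ω →ₗ[k] TreeSpace k Ω →ₗ[k] TreeSpace k Ω}
    {s t u : Set (BinTree (TwoParamOp Ω))}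
    (h : ∀ A ∈ s, ∀ B ∈ t, f (Finsupp.single A 1) (Finsupp.single B 1) ∈ Finsupp.supported k k u)
    {x y : TreeSpace k Ω} (hx : x ∈ Finsupp.supported k k s) (hy : y ∈ Finsupp.supported k k t) :
    f x y ∈ Finsupp.supported k k u := by
  rw [Finsupp.supported_eq_span_single] at hx hy
  induction hx using Submodule.span_induction with
  | zero => simp
  | add x x' _ _ h h' => rw [map_add]; exact add_mem h h'
  | smul c x _ h => rw [map_smul]; exact Submodule.smul_mem _ _ h
  | mem x hx =>
    obtain ⟨A, hA, rfl⟩ := hx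
    induction hy using Submodule.span_induction with
    | zero => simp
    | add x x' _ _ h h' => rw [map_add]; exact add_mem h h'
    | smul c x _ h => rw [map_smul]; exact Submodule.smul_mem _ _ h
    | mem x hx =>
      obtain ⟨B, hB, rfl⟩ := hx
      exact h A hA B hB


/-- The middle rule places `A₂ ≺ B` to the right of a `≻`. A `≻` root could appear there only if
`A₂` had a `≻` root matching `β`, which is exactly what normality of `A₁ ≻ A₂` excludes. -/
theorem rootNormal_succ_of_mem_op {α β γ : Ω} {A₁ A₂ B : BinTree (TwoParamOp Ω)}
    (h : D.RootNormal (succ α β) A₁ A₂) :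
    D.op (prec β γ) A₂ B ∈
      Finsupp.supported k k {X | ∀ δ, D.RootNormal (succ α δ) A₁ X} := by
  have hroot : ∀ ε ζ Y Z, (Finsupp.single (node (prec ε ζ) Y Z) 1 : TreeSpace k Ω) ∈
      Finsupp.supported k k {X | ∀ δ, D.RootNormal (succ α δ) A₁ X} :=
    fun ε ζ Y Z => Finsupp.single_mem_supported _ _ fun δ => trivial
  rcases A₂ with _ | ⟨⟨β₁, β₂⟩ | ⟨β₁, β₂⟩, B₁, B₂⟩
  · rw [op_of_rootNormal D (by simp [RootNormal])]
    exact hroot _ _ _ _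
  · rw [op]
    split_ifs
    · refine add_mem ?_ (Submodule.smul_mem _ _ ?_) <;>
      refine bilinear_mem_supported (s := Set.univ) (t := Set.univ) ?_ ?_ ?_ <;>
      simp [nodeL_single, hroot]
    · exact hroot _ _ _ _
  · rw [op_of_rootNormal D (by simpa [RootNormal] using h)]
    exact hroot _ _ _ _

theorem op_mem_supported (g : TwoParamOp Ω) {A B : BinTree (TwoParamOp Ω)}
    (hA : D.Normal A) (hB : D.Normal B) :
    D.op g A B ∈ Finsupp.supported k k (D.normalTrees (A.leaves + B.leaves)) := by
  induction h : sizeOf A + sizeOf B using Nat.strong_induction_on generalizing g A B with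
  | _ n ih =>
  subst h
  by_cases hg : D.RootNormal g A B
  · rw [op_of_rootNormal D hg]
    exact Finsupp.single_mem_supported _ _ ⟨⟨hg, hA, hB⟩, rfl⟩
  rcases g with ⟨δ, γ⟩ | ⟨α, δ⟩
  · rcases A with _ | ⟨⟨α, β⟩ | ⟨α, β⟩, A₁, A₂⟩
    · simp [RootNormal] at hg
    · simp only [RootNormal, ne_eq, not_not] at hg
      subst hg
      obtain ⟨hr, h₁, h₂⟩ := hA
      -- Rewriting keeps `α` and `A₁`, the only data on which normality at this root depends.
      have key : ∀ δ, D.Normal A₁ ∧ ∀ X, D.RootNormal (prec α δ) A₁ X := by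
        refine fun δ => ⟨h₁, fun X => ?_⟩
        rcases A₁ with _ | ⟨⟨_, _⟩ | ⟨_, _⟩, _, _⟩ <;> trivial
      simp only [op, if_true]
      refine add_mem ?_ (Submodule.smul_mem _ _ ?_) <;>
      · refine bilinear_mem_supported (s := {A₁}) ?_
          (Finsupp.single_mem_supported _ _ rfl) (ih _ (by simp) _ h₂ hB rfl)
        rintro _ rfl X hX
        rw [nodeL_single, mul_one]
        refine Finsupp.single_mem_supported _ _ ⟨⟨(key _).2 _, h₁, hX.1⟩, ?_⟩
        simp only [leaves, hX.2]
        omega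
    · simp only [RootNormal, ne_eq, not_not] at hg
      subst hg
      obtain ⟨hr, h₁, h₂⟩ := hA
      simp only [op, if_true]
      refine bilinear_mem_supported (s := {A₁})
        (t := D.normalTrees (A₂.leaves + B.leaves) ∩
          {X | ∀ δ, D.RootNormal (succ α δ) A₁ X}) ?_
          (Finsupp.single_mem_supported _ _ rfl) ?_
      · rintro _ rfl X hX
        rw [nodeL_single, mul_one]
        refine Finsupp.single_mem_supported _ _ ⟨⟨hX.2 _, h₁, hX.1.1⟩, ?_⟩
        simp only [leaves, hX.1.2]
        omega
      · rw [Finsupp.supported_inter]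
        exact ⟨ih _ (by simp) _ h₂ hB rfl, D.rootNormal_succ_of_mem_op hr⟩
  · rcases B with _ | ⟨⟨β, γ⟩ | ⟨β, γ⟩, B₁, B₂⟩
    · simp [RootNormal] at hg
    · simp [RootNormal] at hg
    · simp only [RootNormal, ne_eq, not_not] at hg
      subst hg
      obtain ⟨hr, h₁, h₂⟩ := hB
      have key : ∀ δ X, D.RootNormal (succ δ γ) X B₂ := by
        intro δ X
        rcases B₂ with _ | ⟨⟨_, _⟩ | ⟨_, _⟩, _, _⟩ <;> trivial
      simp only [op, if_true]
      refine add_mem ?_ (Submodule.smul_mem _ _ ?_) <;>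
      · refine bilinear_mem_supported (t := {B₂}) ?_
          (ih _ (by simp; omega) _ hA h₁ rfl) (Finsupp.single_mem_supported _ _ rfl)
        rintro X hX _ rfl
        rw [nodeL_single, mul_one]
        refine Finsupp.single_mem_supported _ _ ⟨⟨key _ _, hX.1, h₂⟩, ?_⟩
        simp only [leaves, hX.2]
        omega

theorem nf_mem_supported (t : BinTree (TwoParamOp Ω)) :
    D.nf t ∈ Finsupp.supported k k (D.normalTrees t.leaves) := by
  induction t with
  | leaf => exact Finsupp.single_mem_supported _ _ ⟨trivial, rfl⟩
  | node g l r ihl ihr =>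
    change D.opL g (D.nf l) (D.nf r) ∈ _
    refine bilinear_mem_supported ?_ ihl ihr
    rintro A hA B hB
    rw [← op_eq_opL, leaves, ← hA.2, ← hB.2]
    exact D.op_mem_supported g hA.1 hB.1

/-- The normal form of an operation. -/
noncomputable def nfL (n : ℕ) : (Free k Ω).obj n →ₗ[k] TreeSpace k Ω :=
  D.evL n fun _ => Finsupp.single leaf 1

theorem toTrees_sub_nfL_mem (n : ℕ) (x : (Free k Ω).obj n) :
    toTrees k Ω n x - D.nfL n x ∈ D.relSpace := by
  induction x using free_induction with
  | zero => simp
  | add y z hy hz =>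
    rw [map_add, map_add, add_sub_add_comm]
    exact add_mem hy hz
  | single t b =>
    rw [toTrees_single, nfL, evL_single, ← mul_one b, ← smul_eq_mul, ← Finsupp.smul_single,
      smul_eq_mul, mul_one, ← smul_sub]
    exact Submodule.smul_mem _ _ (D.single_sub_nf_mem t.1)

/-- An element is congruent to its normal form, so it lies in the ideal if that vanishes. Conversely
`nfL` is evaluation at particular inputs and so kills the ideal. -/
theorem ker_nfL (n : ℕ) : LinearMap.ker (D.nfL n) = D.relIdeal.carrier n := by
  ext x
  rw [LinearMap.mem_ker]
  constructor
  · intro h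
    have := D.toTrees_sub_nfL_mem n x
    rwa [h, sub_zero, toTrees_mem_relSpace_iff] at this
  · intro h
    have := D.relIdeal_le_evIdeal n h
    simp only [evIdeal, Submodule.mem_iInf, LinearMap.mem_ker] at this
    exact this _

theorem range_nfL (n : ℕ) :
    LinearMap.range (D.nfL n) = Finsupp.supported k k (D.normalTrees n) := by
  apply le_antisymm
  · rintro _ ⟨x, rfl⟩
    induction x using free_induction with
    | zero => simp
    | add y z hy hz => rw [map_add]; exact add_mem hy hz
    | single t b =>
      rw [nfL, evL_single]
      refine Submodule.smul_mem _ _ ?_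
      have := D.nf_mem_supported t.1
      rwa [t.2] at this
  · rw [Finsupp.supported_eq_span_single, Submodule.span_le]
    rintro _ ⟨t, ht, rfl⟩
    refine ⟨freeSingle ⟨t, ht.2⟩ 1, ?_⟩
    rw [nfL, evL_single, one_smul]
    exact D.nf_of_normal ht.1

/-- Normal trees with `n` leaves form a basis of the component of arity `n`. -/
noncomputable def quotientEquiv (n : ℕ) :
    ((Free k Ω).quotient D.relIdeal).obj n ≃ₗ[k] (D.normalTrees n →₀ k) :=
  (Submodule.quotEquivOfEq _ _ (D.ker_nfL n).symm).trans <|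
    (D.nfL n).quotKerEquivRange.trans <|
      (LinearEquiv.ofEq _ _ (D.range_nfL n)).trans (Finsupp.supportedEquivFinsupp _)

theorem finite_and_finrank_quotient (n : ℕ) (hfin : (D.normalTrees n).Finite) :
    Module.Finite k (((Free k Ω).quotient D.relIdeal).obj n) ∧
      Module.finrank k (((Free k Ω).quotient D.relIdeal).obj n) = (D.normalTrees n).ncard := by
  have := hfin.fintype
  refine ⟨Module.Finite.equiv (D.quotientEquiv n).symm, ?_⟩
  rw [(D.quotientEquiv n).finrank_eq, Module.finrank_finsupp_self, Set.ncard_eq_toFinset_card',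
    Set.toFinset_card]

end ParamData

/-! ### Degree and lowest-order term of the counting polynomials. -/

open Polynomial in
/-- The polynomials counting, for `m` internal vertices, the normal trees (first component) and
those whose root is decorated by some `≻` (second component). -/
noncomputable def normalPoly : ℕ → ℤ[X] × ℤ[X]
  | 0 => (1, 0)
  | m + 1 =>
    (∑ i : Fin (m + 1), ((2 * X ^ 2 - X) * (normalPoly i).1 * (normalPoly (m - i)).1
        - X * (normalPoly i).1 * (normalPoly (m - i)).2) + X * (normalPoly m).1,
      ∑ i : Fin (m + 1), (X ^ 2 * (normalPoly i).1 * (normalPoly (m - i)).1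
        - X * (normalPoly i).1 * (normalPoly (m - i)).2))

namespace normalPoly

open Polynomial

theorem fst_succ (m : ℕ) : (normalPoly (m + 1)).1 =
    ∑ i ∈ Finset.range (m + 1), ((2 * X ^ 2 - X) * (normalPoly i).1 * (normalPoly (m - i)).1
        - X * (normalPoly i).1 * (normalPoly (m - i)).2) + X * (normalPoly m).1 := by
  rw [normalPoly, Finset.sum_range]

theorem snd_succ (m : ℕ) : (normalPoly (m + 1)).2 =
    ∑ i ∈ Finset.range (m + 1), (X ^ 2 * (normalPoly i).1 * (normalPoly (m - i)).1
        - X * (normalPoly i).1 * (normalPoly (m - i)).2) := by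
  rw [normalPoly, Finset.sum_range]

/-- Coefficient in the top degree `a + b` of a product. -/
theorem natDegree_coeff_mul {p q : ℤ[X]} {a b : ℕ} {x y : ℤ}
    (hp : p.natDegree ≤ a ∧ p.coeff a = x) (hq : q.natDegree ≤ b ∧ q.coeff b = y) :
    (p * q).natDegree ≤ a + b ∧ (p * q).coeff (a + b) = x * y :=
  ⟨natDegree_mul_le_of_le hp.1 hq.1, by
    rw [coeff_mul_add_eq_of_natDegree_le hp.1 hq.1, hp.2, hq.2]⟩

/-- Only the part `2 * X ^ 2` of the quadratic terms reaches degree `2 * (m + 1)`, so the top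
coefficients satisfy the Catalan recursion up to powers of `2`. -/
theorem natDegree_coeff (m : ℕ) :
    ((normalPoly m).1.natDegree ≤ 2 * m ∧
      (normalPoly m).1.coeff (2 * m) = 2 ^ m * (catalan m : ℤ)) ∧
    (normalPoly m).2.natDegree ≤ 2 * m := by
  induction m using Nat.strong_induction_on with
  | _ m ih =>
  rcases m with _ | m
  · simp [normalPoly]
  have h1 : (2 * X ^ 2 - X : ℤ[X]).natDegree ≤ 2 ∧ (2 * X ^ 2 - X : ℤ[X]).coeff 2 = 2 := by
    constructor
    · compute_degree
    · compute_degree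
  have hlow : ∀ i ≤ m, (X * (normalPoly i).1 * (normalPoly (m - i)).2).natDegree < 2 * (m + 1) := by
    intro i hi
    refine (natDegree_mul_le_of_le (natDegree_mul_le_of_le (natDegree_X_le (R := ℤ))
      (ih i (by omega)).1.1) (ih (m - i) (by omega)).2).trans_lt ?_
    omega
  have hmain : ∀ i ≤ m, ((2 * X ^ 2 - X) * (normalPoly i).1 * (normalPoly (m - i)).1).natDegree
      ≤ 2 * (m + 1) ∧
      ((2 * X ^ 2 - X) * (normalPoly i).1 * (normalPoly (m - i)).1).coeff (2 * (m + 1)) =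
        2 ^ (m + 1) * (catalan i * catalan (m - i) : ℤ) := by
    intro i hi
    have := natDegree_coeff_mul (natDegree_coeff_mul h1 (ih i (by omega)).1)
      (ih (m - i) (by omega)).1
    rw [show 2 + 2 * i + 2 * (m - i) = 2 * (m + 1) by omega] at this
    refine ⟨this.1, this.2.trans ?_⟩
    obtain ⟨j, rfl⟩ := Nat.exists_eq_add_of_le hi
    rw [Nat.add_sub_cancel_left]
    ring
  have hmain' : ∀ i ≤ m, (X ^ 2 * (normalPoly i).1 * (normalPoly (m - i)).1).natDegree
      ≤ 2 * (m + 1) := by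
    intro i hi
    refine (natDegree_mul_le_of_le (natDegree_mul_le_of_le (natDegree_X_pow_le (R := ℤ) 2)
      (ih i (by omega)).1.1) (ih (m - i) (by omega)).1.1).trans ?_
    omega
  have hX1 : (X * (normalPoly m).1).natDegree < 2 * (m + 1) := by
    refine (natDegree_mul_le_of_le (natDegree_X_le (R := ℤ)) (ih m (by omega)).1.1).trans_lt ?_
    omega
  refine ⟨⟨?_, ?_⟩, ?_⟩
  · rw [fst_succ]
    refine natDegree_add_le_of_degree_le (natDegree_sum_le_of_forall_le _ _ fun i hi => ?_) hX1.le
    have hi : i ≤ m := by simpa [Nat.lt_succ_iff] using hi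
    exact natDegree_sub_le_of_le (hmain i hi).1 (hlow i hi).le |>.trans (by simp)
  · rw [fst_succ, coeff_add, coeff_eq_zero_of_natDegree_lt hX1, add_zero, finsetSum_coeff,
      catalan_succ, Finset.sum_range]
    push_cast
    rw [Finset.mul_sum]
    refine Finset.sum_congr rfl fun i _ => ?_
    have hi : (i : ℕ) ≤ m := Nat.lt_succ_iff.1 i.2
    rw [coeff_sub, coeff_eq_zero_of_natDegree_lt (hlow i hi), sub_zero, (hmain i hi).2]
  · rw [snd_succ]
    refine natDegree_sum_le_of_forall_le _ _ fun i hi => ?_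
    have hi : i ≤ m := by simpa [Nat.lt_succ_iff] using hi
    exact natDegree_sub_le_of_le (hmain' i hi) (hlow i hi).le |>.trans (by simp)

/-- To lowest order only the summands with an empty side (`i = 0` or `i` maximal) and the linear
term survive. The constant terms then obey `a' = -a - b` and `b' = -b`. -/
theorem exists_eq_X_pow_mul (m : ℕ) :
    ∃ a b : ℤ[X], (normalPoly (m + 1)).1 = X ^ (m + 2) * a ∧
      (normalPoly (m + 1)).2 = X ^ (m + 2) * b ∧
      a.eval 0 = (-1) ^ m * (m + 2 : ℤ) ∧ b.eval 0 = (-1) ^ m := by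
  induction m using Nat.strong_induction_on with
  | _ m ih =>
  rcases m with _ | m
  · refine ⟨2, 1, ?_, ?_, by simp, by simp⟩
    · rw [fst_succ]
      simp [normalPoly]
      ring
    · rw [snd_succ]
      simp [normalPoly]
  choose! a b ha hb ha0 hb0 using ih
  -- When both subtrees are nontrivial the product of their powers of `X`, together with the factor
  -- `X`, exceeds the required `X ^ (m + 3)` by one, so these summands do not affect the constant
  -- terms.
  have mid : ∃ e f : ℤ[X],
      (∑ i ∈ Finset.range m, ((2 * X ^ 2 - X) * (normalPoly (i + 1)).1 *
        (normalPoly (m + 1 - (i + 1))).1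
          - X * (normalPoly (i + 1)).1 * (normalPoly (m + 1 - (i + 1))).2)) = X ^ (m + 4) * e ∧
      (∑ i ∈ Finset.range m, (X ^ 2 * (normalPoly (i + 1)).1 *
        (normalPoly (m + 1 - (i + 1))).1
          - X * (normalPoly (i + 1)).1 * (normalPoly (m + 1 - (i + 1))).2)) = X ^ (m + 4) * f := by
    refine ⟨∑ i ∈ Finset.range m, ((2 * X - 1) * a i * a (m - 1 - i) - a i * b (m - 1 - i)),
      ∑ i ∈ Finset.range m, (X * a i * a (m - 1 - i) - a i * b (m - 1 - i)), ?_, ?_⟩ <;>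
    · rw [Finset.mul_sum]
      refine Finset.sum_congr rfl fun i hi => ?_
      have hi := Finset.mem_range.1 hi
      obtain ⟨j, rfl⟩ := Nat.exists_eq_add_of_lt hi
      rw [show i + j + 1 + 1 - (i + 1) = j + 1 by omega, show i + j + 1 - 1 - i = j by omega,
        ha i (by omega), ha j (by omega), hb j (by omega)]
      ring
  obtain ⟨e, f, he, hf⟩ := mid
  refine ⟨(2 * X - 1) * 2 * a m - b m + a m + X * e,
    2 * X * a m - b m + X * f, ?_, ?_, ?_, ?_⟩
  · rw [fst_succ, Finset.sum_range_succ, Finset.sum_range_succ', he]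
    simp only [Nat.sub_self, Nat.sub_zero, ha m (by omega), hb m (by omega)]
    simp only [normalPoly]
    ring
  · rw [snd_succ, Finset.sum_range_succ, Finset.sum_range_succ', hf]
    simp only [Nat.sub_self, Nat.sub_zero, ha m (by omega), hb m (by omega)]
    simp only [normalPoly]
    ring
  · simp [ha0 m (by omega), hb0 m (by omega)]
    ring
  · simp [ha0 m (by omega), hb0 m (by omega)]
    ring

end normalPoly

/-! ### Counting normal trees. -/

/-- The generators are two copies of the pairs of parameters. -/
def TwoParamOp.equivSum (Ω : Type v) : Ω × Ω ⊕ Ω × Ω ≃ TwoParamOp Ω where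
  toFun := Sum.elim (fun p => prec p.1 p.2) fun p => succ p.1 p.2
  invFun
    | prec α β => Sum.inl (α, β)
    | succ α β => Sum.inr (α, β)
  left_inv := by rintro (_ | _) <;> rfl
  right_inv := by rintro (_ | _) <;> rfl

instance TwoParamOp.instFintype (Ω : Type v) [Fintype Ω] : Fintype (TwoParamOp Ω) :=
  Fintype.ofEquiv _ (TwoParamOp.equivSum Ω)

theorem TwoParamOp.sum_eq {Ω : Type v} [Fintype Ω] (f : TwoParamOp Ω → ℤ) :
    ∑ g, f g = ∑ α, ∑ β, f (prec α β) + ∑ α, ∑ β, f (succ α β) := by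
  rw [← (TwoParamOp.equivSum Ω).sum_comp, Fintype.sum_sum_type, Fintype.sum_prod_type,
    Fintype.sum_prod_type]
  rfl

namespace ParamData

open TwoParamOp BinTree

variable {k : Type u} [Field k] {Ω : Type v} (D : ParamData k Ω) [Fintype Ω]

open Classical in
/-- The finite set of normal trees with `m` internal vertices. -/
noncomputable def normalFinset : ℕ → Finset (BinTree (TwoParamOp Ω))
  | 0 => {leaf}
  | m + 1 => Finset.univ.biUnion fun i : Fin (m + 1) =>
    (((normalFinset i ×ˢ normalFinset (m - i)) ×ˢ (Finset.univ : Finset (TwoParamOp Ω))).filter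
      fun p => D.RootNormal p.2 p.1.1 p.1.2).image fun p => node p.2 p.1.1 p.1.2

theorem one_le_leaves {G : Type*} (t : BinTree G) : 1 ≤ t.leaves := by
  induction t with
  | leaf => simp [leaves]
  | node g l r ihl ihr => simp only [leaves]; omega

theorem mem_normalFinset {m : ℕ} {t : BinTree (TwoParamOp Ω)} :
    t ∈ D.normalFinset m ↔ t ∈ D.normalTrees (m + 1) := by
  induction m using Nat.strong_induction_on generalizing t with
  | _ m ih =>
  rcases m with _ | m
  · rcases t with _ | ⟨g, l, r⟩
    · simp [normalFinset, normalTrees, Normal, leaves]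
    · have := one_le_leaves l
      have := one_le_leaves r
      simp only [normalFinset, Finset.mem_singleton, reduceCtorEq, normalTrees, leaves,
        Set.mem_ofPred_eq, false_iff, not_and]
      omega
  · rw [normalFinset]
    simp only [Finset.mem_biUnion, Finset.mem_univ, true_and, Finset.mem_image,
      Finset.mem_filter, Finset.mem_product, and_true, Prod.exists]
    constructor
    · rintro ⟨i, l, r, g, ⟨⟨hl, hr⟩, hg⟩, rfl⟩
      rw [ih _ i.2] at hl
      rw [ih _ (by omega)] at hr
      refine ⟨⟨hg, hl.1, hr.1⟩, ?_⟩
      have := i.2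
      simp only [leaves, hl.2, hr.2]
      omega
    · rintro ⟨ht, htl⟩
      rcases t with _ | ⟨g, l, r⟩
      · simp [leaves] at htl
      · have := one_le_leaves l
        have := one_le_leaves r
        simp only [leaves] at htl
        refine ⟨⟨l.leaves - 1, by omega⟩, l, r, g, ⟨⟨?_, ?_⟩, ht.1⟩, rfl⟩
        · rw [ih _ (by simp only; omega)]
          exact ⟨ht.2.1, by simp only; omega⟩
        · rw [ih _ (by simp only; omega)]
          exact ⟨ht.2.2, by simp only; omega⟩

open Classical in
theorem sum_normalFinset_succ (m : ℕ) (φ : BinTree (TwoParamOp Ω) → ℤ) :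
    ∑ t ∈ D.normalFinset (m + 1), φ t = ∑ i ∈ Finset.range (m + 1), ∑ l ∈ D.normalFinset i,
      ∑ r ∈ D.normalFinset (m - i), ∑ g, if D.RootNormal g l r then φ (node g l r) else 0 := by
  rw [normalFinset, Finset.sum_biUnion, Finset.sum_range]
  · refine Finset.sum_congr rfl fun i _ => ?_
    rw [Finset.sum_image, Finset.sum_filter, Finset.sum_product, Finset.sum_product]
    rintro ⟨⟨l, r⟩, g⟩ - ⟨⟨l', r'⟩, g'⟩ - h
    simp only [node.injEq] at h
    simp [h]
  · rintro i - j - hij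
    rw [Function.onFun, Finset.disjoint_left]
    intro t hi hj
    simp only [Finset.mem_image, Finset.mem_filter, Finset.mem_product, Finset.mem_univ, and_true,
      Prod.exists, mem_normalFinset] at hi hj
    obtain ⟨l, r, g, ⟨⟨hl, -⟩, -⟩, rfl⟩ := hi
    obtain ⟨l', r', g', ⟨⟨hl', -⟩, -⟩, h⟩ := hj
    simp only [node.injEq] at h
    refine hij (Fin.ext ?_)
    have h₁ := hl.2
    have h₂ := hl'.2
    rw [h.2.1] at h₂
    omega

/-- The indicator function of the trees with root decorated by some `≻`. -/
def succRoot : BinTree (TwoParamOp Ω) → ℤ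
  | node (succ _ _) _ _ => 1
  | _ => 0

/-- The indicator function of the leaf. -/
def leafInd : BinTree (TwoParamOp Ω) → ℤ
  | leaf => 1
  | _ => 0

-- Above a nonleaf left subtree exactly one value of `δ` is forbidden, for every `γ`, whatever the
-- products are; a leaf forbids nothing.
open Classical in
theorem sum_prec (l r : BinTree (TwoParamOp Ω)) :
    ∑ δ, ∑ γ, (if D.RootNormal (prec δ γ) l r then 1 else 0 : ℤ) =
      (Fintype.card Ω : ℤ) ^ 2 - Fintype.card Ω + Fintype.card Ω * leafInd l := by
  rcases l with _ | ⟨⟨α, β⟩ | ⟨α, β⟩, l₁, l₂⟩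
  · simp [RootNormal, leafInd, sq]
  · have h : ∀ δ γ, (if D.RootNormal (prec δ γ) (node (prec α β) l₁ l₂) r then 1 else 0 : ℤ) =
        1 - if D.la α β = δ then 1 else 0 := by
      intro δ γ
      by_cases h : D.la α β = δ <;> simp [RootNormal, h]
    simp [h, leafInd]
    ring
  · have h : ∀ δ γ, (if D.RootNormal (prec δ γ) (node (succ α β) l₁ l₂) r then 1 else 0 : ℤ) =
        1 - if D.ra α β = δ then 1 else 0 := by
      intro δ γ
      by_cases h : D.ra α β = δ <;> simp [RootNormal, h]
    simp [h, leafInd]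
    ring

open Classical in
theorem sum_succ (l r : BinTree (TwoParamOp Ω)) :
    ∑ δ, ∑ γ, (if D.RootNormal (succ δ γ) l r then 1 else 0 : ℤ) =
      (Fintype.card Ω : ℤ) ^ 2 - Fintype.card Ω * succRoot r := by
  rcases r with _ | ⟨⟨α, β⟩ | ⟨α, β⟩, l₁, l₂⟩
  · simp [RootNormal, succRoot, sq]
  · simp [RootNormal, succRoot, sq]
  · have h : ∀ δ γ, (if D.RootNormal (succ δ γ) l (node (succ α β) l₁ l₂) then 1 else 0 : ℤ) =
        1 - if D.ra α β = γ then 1 else 0 := by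
      intro δ γ
      by_cases h : D.ra α β = γ <;> simp [RootNormal, h]
    simp [h, succRoot]
    ring

theorem sum_leafInd (m : ℕ) :
    ∑ t ∈ D.normalFinset m, leafInd t = if m = 0 then 1 else 0 := by
  split_ifs with h
  · subst h
    simp [normalFinset, leafInd]
  · refine Finset.sum_eq_zero fun t ht => ?_
    rw [D.mem_normalFinset (t := t)] at ht
    rcases t with _ | _
    · have := ht.2
      simp only [leaves] at this
      omega
    · rfl

/-- Both counts are needed together: the number of labels allowed for a `≻` root depends on whether
the right subtree has a `≻` root. -/
theorem sum_normalFinset (m : ℕ) :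
    ∑ _t ∈ D.normalFinset m, (1 : ℤ) = (normalPoly m).1.eval (Fintype.card Ω : ℤ) ∧
    ∑ t ∈ D.normalFinset m, succRoot t = (normalPoly m).2.eval (Fintype.card Ω : ℤ) := by
  classical
  induction m using Nat.strong_induction_on with
  | _ m ih =>
  rcases m with _ | m
  · simp [normalFinset, normalPoly, succRoot]
  rw [sum_normalFinset_succ, sum_normalFinset_succ, normalPoly.fst_succ, normalPoly.snd_succ]
  simp only [Polynomial.eval_add, Polynomial.eval_finsetSum, Polynomial.eval_sub,
    Polynomial.eval_mul, Polynomial.eval_X, Polynomial.eval_pow, Polynomial.eval_ofNat]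
  set w : ℤ := (Fintype.card Ω : ℤ)
  constructor
  -- The linear term of the recursion is the correction for a left subtree equal to the leaf, which
  -- occurs only for `i = 0`.
  · have hleaf : w * (normalPoly m).1.eval w = ∑ i ∈ Finset.range (m + 1),
        w * (∑ l ∈ D.normalFinset i, leafInd l) * ∑ r ∈ D.normalFinset (m - i), (1 : ℤ) := by
      rw [Finset.sum_eq_single 0]
      · rw [sum_leafInd, if_pos rfl, mul_one, Nat.sub_zero, (ih m (by omega)).1]
      · intro i _ hi
        rw [sum_leafInd, if_neg hi, mul_zero, zero_mul]
      · simp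
    rw [hleaf, ← Finset.sum_add_distrib]
    refine Finset.sum_congr rfl fun i hi => ?_
    have hi := Finset.mem_range.1 hi
    rw [← (ih i hi).1, ← (ih (m - i) (by omega)).1, ← (ih (m - i) (by omega)).2]
    simp only [sum_eq, sum_prec, sum_succ, Finset.sum_add_distrib, Finset.sum_sub_distrib,
      ← Finset.mul_sum, Finset.sum_const, nsmul_eq_mul, mul_one]
    ring
  · refine Finset.sum_congr rfl fun i hi => ?_
    have hi := Finset.mem_range.1 hi
    rw [← (ih i hi).1, ← (ih (m - i) (by omega)).1, ← (ih (m - i) (by omega)).2]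
    simp only [sum_eq, succRoot, ite_self, Finset.sum_const_zero, zero_add, sum_succ,
      Finset.sum_sub_distrib, ← Finset.mul_sum, Finset.sum_const, nsmul_eq_mul, mul_one]
    ring

theorem normalTrees_finite_ncard (m : ℕ) : (D.normalTrees (m + 1)).Finite ∧
    ((D.normalTrees (m + 1)).ncard : ℤ) = (normalPoly m).1.eval (Fintype.card Ω : ℤ) := by
  have h : D.normalTrees (m + 1) = D.normalFinset m := by
    ext t
    rw [Finset.mem_coe, mem_normalFinset]
  rw [h, Set.ncard_coe_finset, ← (D.sum_normalFinset m).1]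
  exact ⟨Finset.finite_toSet _, by simp⟩

theorem finite_and_finrank_of_rel_iff {R : ∀ n, (Free k Ω).obj n → Prop}
    (hR : ∀ n x, R n x ↔ D.Rel n x) {n : ℕ} (hn : 1 ≤ n) :
    Module.Finite k (((Free k Ω).quotient ((Free k Ω).idealSpan fun n => {x | R n x})).obj n) ∧
      (Module.finrank k
        (((Free k Ω).quotient ((Free k Ω).idealSpan fun n => {x | R n x})).obj n) : ℤ) =
          (normalPoly (n - 1)).1.eval (Fintype.card Ω : ℤ) := by
  have h : ((Free k Ω).idealSpan fun n => {x | R n x}) = D.relIdeal := by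
    simp only [hR, relIdeal]
  rw [h]
  obtain ⟨m, rfl⟩ := Nat.exists_eq_add_of_le' hn
  obtain ⟨hf, hc⟩ := D.normalTrees_finite_ncard m
  obtain ⟨hf', hc'⟩ := D.finite_and_finrank_quotient (m + 1) hf
  exact ⟨hf', by rw [hc', hc, Nat.add_sub_cancel]⟩

end ParamData

/-! ### Application to the dendriform and duplicial operads. -/

/-- The rewriting data of two-parameter dendriform algebras. -/
def ParamData.ofDiassociative (k : Type u) [Field k] (Ω : Type v) [DiassociativeSemigroup Ω] :
    ParamData k Ω where
  la := DiassociativeSemigroup.la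
  ra := DiassociativeSemigroup.ra
  c := 1
  la_assoc := DiassociativeSemigroup.la_assoc
  ra_la := DiassociativeSemigroup.ra_la
  ra_assoc α β γ := by
    rw [DiassociativeSemigroup.ra_ra_eq_la_ra, DiassociativeSemigroup.ra_assoc]
  diassociative := Or.inr ⟨rfl, fun α β γ => (DiassociativeSemigroup.la_la_eq_la_ra α β γ).symm,
    fun α β γ => (DiassociativeSemigroup.ra_ra_eq_la_ra α β γ).symm⟩

/-- The rewriting data of two-parameter duplicial algebras. -/
def ParamData.ofDuplicial (k : Type u) [Field k] (Ω : Type v) [DuplicialSemigroup Ω] :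
    ParamData k Ω where
  la := DuplicialSemigroup.la
  ra := DuplicialSemigroup.ra
  c := 0
  la_assoc := DuplicialSemigroup.la_assoc
  ra_la := DuplicialSemigroup.ra_la
  ra_assoc := DuplicialSemigroup.ra_assoc
  diassociative := Or.inl rfl

theorem dendRel_iff (k : Type u) [Field k] (Ω : Type v) [DiassociativeSemigroup Ω] (n : ℕ)
    (x : (TwoParamOp.Free k Ω).obj n) :
    DendRel k Ω n x ↔ (ParamData.ofDiassociative k Ω).Rel n x := by
  have hc : (ParamData.ofDiassociative k Ω).c = 1 := rfl
  constructor
  · rintro (⟨α, β, γ⟩ | ⟨α, β, γ⟩ | ⟨α, β, γ⟩)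
    · have := ParamData.Rel.prec (D := ParamData.ofDiassociative k Ω) α β γ
      rwa [hc, one_smul] at this
    · exact ParamData.Rel.mid (D := ParamData.ofDiassociative k Ω) α β γ
    · have := ParamData.Rel.succ (D := ParamData.ofDiassociative k Ω) α β γ
      rwa [hc, one_smul] at this
  · rintro (⟨α, β, γ⟩ | ⟨α, β, γ⟩ | ⟨α, β, γ⟩)
    · rw [hc, one_smul]
      exact DendRel.prec α β γ
    · exact DendRel.mid α β γ
    · rw [hc, one_smul]
      exact DendRel.succ α β γ

theorem dupRel_iff (k : Type u) [Field k] (Ω : Type v) [DuplicialSemigroup Ω] (n : ℕ)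
    (x : (TwoParamOp.Free k Ω).obj n) :
    DupRel k Ω n x ↔ (ParamData.ofDuplicial k Ω).Rel n x := by
  have hc : (ParamData.ofDuplicial k Ω).c = 0 := rfl
  constructor
  · rintro (⟨α, β, γ⟩ | ⟨α, β, γ⟩ | ⟨α, β, γ⟩)
    · have := ParamData.Rel.prec (D := ParamData.ofDuplicial k Ω) α β γ
      rwa [hc, zero_smul, add_zero] at this
    · exact ParamData.Rel.mid (D := ParamData.ofDuplicial k Ω) α β γ
    · have := ParamData.Rel.succ (D := ParamData.ofDuplicial k Ω) α β γ
      rwa [hc, zero_smul, add_zero] at this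
  · rintro (⟨α, β, γ⟩ | ⟨α, β, γ⟩ | ⟨α, β, γ⟩)
    · rw [hc, zero_smul, add_zero]
      exact DupRel.prec α β γ
    · exact DupRel.mid α β γ
    · rw [hc, zero_smul, add_zero]
      exact DupRel.succ α β γ

theorem mainTheorem7 (n : ℕ) (hn : 1 ≤ n) :
    ∃ r : Polynomial ℤ,
      (∀ (k : Type u) [Field k] (Ω : Type v) [Fintype Ω] [DiassociativeSemigroup Ω],
        Module.Finite k ((Dend2 k Ω).obj n) ∧
          (Module.finrank k ((Dend2 k Ω).obj n) : ℤ) = r.eval (Fintype.card Ω : ℤ)) ∧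
      (∀ (k : Type u) [Field k] (Ω : Type v) [Fintype Ω] [DuplicialSemigroup Ω],
        Module.Finite k ((Dup2 k Ω).obj n) ∧
          (Module.finrank k ((Dup2 k Ω).obj n) : ℤ) = r.eval (Fintype.card Ω : ℤ)) ∧
      r.degree = ((2 * n - 2 : ℕ) : WithBot ℕ) ∧
      r.leadingCoeff = 2 ^ (n - 1) * (catalan (n - 1) : ℤ) ∧
      (2 ≤ n → ∃ t : Polynomial ℤ,
        r = Polynomial.X ^ n * t ∧ t.eval 0 = (-1) ^ n * (n : ℤ)) := by
  -- A tree with `n` leaves has `n - 1` internal vertices, and the number `Cat_n` of the statement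
  -- is `catalan (n - 1)`.
  obtain ⟨⟨hdeg, hcoeff⟩, -⟩ := normalPoly.natDegree_coeff (n - 1)
  have hne : (2 ^ (n - 1) * (catalan (n - 1) : ℤ)) ≠ 0 := by
    have : catalan (n - 1) ≠ 0 := by
      intro h
      have h' := succ_mul_catalan_eq_centralBinom (n - 1)
      rw [h, mul_zero] at h'
      exact (Nat.centralBinom_ne_zero _) h'.symm
    positivity
  have hnat : (normalPoly (n - 1)).1.natDegree = 2 * (n - 1) :=
    le_antisymm hdeg (Polynomial.le_natDegree_of_ne_zero (by rwa [hcoeff]))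
  refine ⟨(normalPoly (n - 1)).1, ?_, ?_, ?_, ?_, ?_⟩
  · intro k _ Ω _ _
    exact ParamData.finite_and_finrank_of_rel_iff _ (dendRel_iff k Ω) hn
  · intro k _ Ω _ _
    exact ParamData.finite_and_finrank_of_rel_iff _ (dupRel_iff k Ω) hn
  · rw [Polynomial.degree_eq_natDegree, hnat, Nat.mul_sub]
    intro h
    rw [h, Polynomial.coeff_zero] at hcoeff
    exact hne hcoeff.symm
  · rw [Polynomial.leadingCoeff, hnat, hcoeff]
  · intro h2
    obtain ⟨m, rfl⟩ := Nat.exists_eq_add_of_le' h2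
    obtain ⟨a, -, ha, -, ha0, -⟩ := normalPoly.exists_eq_X_pow_mul m
    refine ⟨a, ha, ?_⟩
    rw [ha0]
    push_cast
    ring
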